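/- Let $S^3_1=\{x\in\mathbf R^4_1 : \langle x,x\rangle=1\}$, $\langle x,y\rangle=-x_0y_0+x_1y_1+x_2y_2+x_3y_3$, be de Sitter 3-space, and let $\mathcal C=\{(x,y,z)\in\mathbf R^3 : x^2+y^2=z^2\}$ be the standard double cone. A map from an open subset $U$ of $\mathcal C$ is real analytic if it is the restriction of a real analytic map on an open $\Omega\subset\mathbf R^3$ with $\mathcal C\cap\Omega=U$. A 2-dimensional (real analytic) DC-manifold is a locally compact Hausdorff second countable space with an atlas of homeomorphisms from open sets onto connected open subsets of $\mathcal C$, with real analytic transition maps; its DC-points are the points that correspond to the vertex $\mathbf 0$ of $\mathcal C$. A map $f$ from a 2-dimensional DC-manifold to a real analytic 3-manifold $N$ is a real analytic DC-immersion if it is real analytic in the charts and, around each point, there are a local DC-coordinate system $(U,\varphi)$ and a real analytic local coordinate system $\Phi$ of $N$, defined on a neighbourhood of $f(U)$, with $\Phi\circ f\circ\varphi^{-1}(a)=a$ for $a\in\varphi(U)$. A real analytic DC-immersion $f$ of a connected 2-dimensional DC-manifold to $S^3_1$ is space-like CMC-1 if off the DC-points it is a space-like immersion whose mean curvature with respect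 to a continuous unit normal field is $1$. A non-empty $S\subset N$ is analytically complete if every real analytic $\Gamma:[0,1]\to N$ with $\Gamma([0,\varepsilon))\subset S$ for some $\varepsilon\in(0,1)$ satisfies $\Gamma([0,1])\subset S$. A continuous map $f:X\to N$ is $C^0$-arc-proper if for every continuous $\sigma:[0,1)\to X$ such that $f\circ\sigma$ extends continuously to $[0,1]\to N$ there are $t_k\in[0,1)$ with $t_k\to1$ such that $\sigma(t_k)$ converges in $X$. **Proposition.** Let $\nu>0$, $\nu\ne1$, put $T^1=\mathbf R/2\pi\mathbf Z$, $$x_0(s)=\sin s\,\sinh\tfrac s\nu-\tfrac{\nu^2-1}{2\nu}\cos s\,\cosh\tfrac s\nu,\qquad x_3(s)=\sin s\,\cosh\tfrac s\nu-\tfrac{\nu^2-1}{2\nu}\cos s\,\sinh\tfrac s\nu,$$ and consider the G-catenoid of type TH $$f=f^\nu_{\mathrm{TH}}:\mathbf R\times T^1\to S^3_1,\qquad f(s,\theta)=\Bigl(x_0(s),\ \tfrac{\nu^2+1}{2\nu}\cos s\cos\theta,\ \tfrac{\nu^2+1}{2\nu}\cos s\sin\theta,\ x_3(s)\Bigr),$$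 the set $$\mathcal X=\Bigl\{(\xi,\eta,s)\in\mathbf R^3 : \xi^2+\eta^2=\tfrac{(1+\nu^2)^2\cos^2s}{4\nu^2}\Bigr\}$$ and the map $\tilde f:\mathcal X\to S^3_1$, $\tilde f(\xi,\eta,s)=(x_0(s),\xi,\eta,x_3(s))$. Then: 1. $f$ is real analytic, $f(s,\theta)=\tilde f\bigl(\tfrac{\nu^2+1}{2\nu}\cos s\cos\theta,\tfrac{\nu^2+1}{2\nu}\cos s\sin\theta,s\bigr)$, and $f$ and $\tilde f$ have the same image. 2. $\mathcal X$ has the structure of a 2-dimensional real analytic DC-manifold for which the inclusion $\mathcal X\hookrightarrow\mathbf R^3$ is a real analytic DC-immersion, whose DC-points are the countably infinitely many points $(0,0,\tfrac\pi2+k\pi)$, $k\in\mathbf Z$, and with respect to which $\tilde f$ is a real analytic space-like CMC-1 DC-immersion. 3. The image of $f$ is analytically complete in $S^3_1$. 4. Neither $f$ nor $\tilde f$ is a proper map, but $\tilde f$ is $C^0$-arc-proper. -/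

import Mathlib

open Set Filter Topology

noncomputable section

/-! ## Real analytic maps between subsets of Euclidean spaces -/

/-- A map `g` from the subset `C` of the normed space `E` to `F` is real analytic on the
relatively open set `U ⊆ C` if there are an open set `Ω` of `E` with `C ∩ Ω = U` and a real
analytic map on `Ω` that restricts to `g` on `U`. -/
def IsAnalyticOnSubset {E F : Type*} [NormedAddCommGroup E] [NormedSpace ℝ E]
    [NormedAddCommGroup F] [NormedSpace ℝ F] {C : Set E} (U : Set C) (g : C → F) : Prop :=
  ∃ Ω : Set E, IsOpen Ω ∧ (Subtype.val ⁻¹' Ω : Set C) = U ∧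
    ∃ G : E → F, AnalyticOnNhd ℝ G Ω ∧ ∀ x ∈ U, G x = g x

/-- A real analytic diffeomorphism from a relatively open subset `Φ.source` of `N ⊆ E` onto
an open subset `Φ.target` of `ℝⁿ`. For an `n`-dimensional real analytic submanifold `N` of `E`
these are exactly its real analytic local coordinate systems. -/
def IsAnalyticCoordinate {E : Type*} [NormedAddCommGroup E] [NormedSpace ℝ E] {N : Set E} {n : ℕ}
    (Φ : OpenPartialHomeomorph N (Fin n → ℝ)) : Prop :=
  IsAnalyticOnSubset Φ.source Φ ∧ AnalyticOnNhd ℝ (fun y => (Φ.symm y : E)) Φ.target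

/-! ## Double-cone manifolds -/

/-- The `m`-dimensional standard double cone
`x₁² + ⋯ + x_m² = x_{m+1}²` in `ℝ^{m+1}`. -/
def doubleCone (m : ℕ) : Set (Fin (m + 1) → ℝ) :=
  {x | ∑ j : Fin m, x j.castSucc ^ 2 = x (Fin.last m) ^ 2}

/-- The structure of an `m`-dimensional real analytic double-cone manifold (DC-manifold) on `X`. -/
structure DCStructure (m : ℕ) (X : Type*) [TopologicalSpace X] where
  t2 : T2Space X
  locallyCompact : LocallyCompactSpace X
  secondCountable : SecondCountableTopology X
  charts : Set (OpenPartialHomeomorph X (doubleCone m))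
  covers : ∀ x : X, ∃ φ ∈ charts, x ∈ φ.source
  connected : ∀ φ ∈ charts, IsConnected φ.target
  compatible : ∀ φ ∈ charts, ∀ ψ ∈ charts,
    IsAnalyticOnSubset (φ.symm.trans ψ).source
      (fun a => (ψ (φ.symm a) : Fin (m + 1) → ℝ))

namespace DCStructure

variable {m : ℕ} {X : Type*} [TopologicalSpace X] (D : DCStructure m X)

/-- Local DC-coordinate systems of a DC-manifold. -/
def IsLocalCoordinate (ψ : OpenPartialHomeomorph X (doubleCone m)) : Prop :=
  ∀ φ ∈ D.charts,
    IsAnalyticOnSubset (ψ.symm.trans φ).source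
      (fun a => (φ (ψ.symm a) : Fin (m + 1) → ℝ)) ∧
    IsAnalyticOnSubset (φ.symm.trans ψ).source
      (fun a => (ψ (φ.symm a) : Fin (m + 1) → ℝ))

/-- The set of DC-points: the points that some local DC-coordinate system sends to the
standard double-cone point, the origin. -/
def dcPoints : Set X :=
  {p | ∃ ψ : OpenPartialHomeomorph X (doubleCone m), D.IsLocalCoordinate ψ ∧ p ∈ ψ.source ∧
    (ψ p : Fin (m + 1) → ℝ) = 0}

variable {E : Type*} [NormedAddCommGroup E] [NormedSpace ℝ E] {N : Set E}

/-- DC-analytic maps into a real analytic submanifold `N` of `E`. -/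
def IsDCAnalytic (f : X → N) : Prop :=
  ∀ φ ∈ D.charts, IsAnalyticOnSubset φ.target (fun a => (f (φ.symm a) : E))

/-- `p` is a DC-regular point of `f : X → N`, where `N` has dimension `n > m`: in a local
DC-coordinate system `φ` at `p` and a real analytic local coordinate system `Φ` of `N` at `f p`,
the map `f` is `a ↦ (a, 0)` with `0 ∈ ℝ^{n-m-1}`. -/
def IsDCRegularAt (n : ℕ) (f : X → N) (p : X) : Prop :=
  ∃ φ : OpenPartialHomeomorph X (doubleCone m), D.IsLocalCoordinate φ ∧ p ∈ φ.source ∧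
    ∃ Φ : OpenPartialHomeomorph N (Fin n → ℝ), IsAnalyticCoordinate Φ ∧
      ∀ a ∈ φ.target, f (φ.symm a) ∈ Φ.source ∧
        Φ (f (φ.symm a)) =
          fun i : Fin n => if h : (i : ℕ) < m + 1 then (a : Fin (m + 1) → ℝ) ⟨i, h⟩ else 0

/-- Real analytic DC-immersions into a real analytic submanifold `N ⊆ E` of dimension `n > m`. -/
def IsDCImmersion (n : ℕ) (f : X → N) : Prop :=
  m < n ∧ D.IsDCAnalytic f ∧ ∀ p, D.IsDCRegularAt n f p

end DCStructure

/-! ## Analytic completeness and arc-properness -/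

/-- A subset `S` of a real analytic submanifold `N` of `E` is analytically complete if it is
nonempty and every real analytic curve `[0,1] → N` that starts in `S` on some `[0, ε)`
stays in `S`. -/
def IsAnalyticallyComplete {E : Type*} [NormedAddCommGroup E] [NormedSpace ℝ E] {N : Set E}
    (S : Set N) : Prop :=
  S.Nonempty ∧
    ∀ Γ : ℝ → E, AnalyticOnNhd ℝ Γ (Icc 0 1) → (∀ t ∈ Icc (0 : ℝ) 1, Γ t ∈ N) →
      (∃ ε ∈ Ioo (0 : ℝ) 1, ∀ t ∈ Ico 0 ε, Γ t ∈ Subtype.val '' S) →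
      ∀ t ∈ Icc (0 : ℝ) 1, Γ t ∈ Subtype.val '' S

/-- `C^r`-arc-properness of a continuous map `f : X → N`, where `r` is a natural number,
`∞` or `ω`: along every continuous curve `σ : [0,1) → X` for which `f ∘ σ` extends to a `C^r`-map
`[0,1] → N` there is a sequence `t_k → 1` such that `σ(t_k)` converges in `X`. -/
def IsArcProper (r : WithTop ℕ∞) {X : Type*} [TopologicalSpace X]
    {E : Type*} [NormedAddCommGroup E] [NormedSpace ℝ E] {N : Set E} (f : X → N) : Prop :=
  Continuous f ∧
    ∀ σ : ℝ → X, ContinuousOn σ (Ico 0 1) →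
      (∃ Γ : ℝ → E, ContDiffOn ℝ r Γ (Icc 0 1) ∧ (∀ t ∈ Icc (0 : ℝ) 1, Γ t ∈ N) ∧
        ∀ t ∈ Ico (0 : ℝ) 1, Γ t = f (σ t)) →
      ∃ u : ℕ → ℝ, (∀ k, u k ∈ Ico (0 : ℝ) 1) ∧ Tendsto u atTop (𝓝 1) ∧
        ∃ p : X, Tendsto (fun k => σ (u k)) atTop (𝓝 p)

/-! ## Space-like CMC-1 surfaces in de Sitter 3-space -/

/-- The inner product of signature `(-,+,+,+)` of Lorentz-Minkowski 4-space. -/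
def lorentz (x y : Fin 4 → ℝ) : ℝ := -(x 0 * y 0) + x 1 * y 1 + x 2 * y 2 + x 3 * y 3

/-- De Sitter 3-space `S³₁`. -/
def deSitter3 : Set (Fin 4 → ℝ) := {x | lorentz x x = 1}

/-- The partial derivative with respect to the first variable. -/
def partialU (P : ℝ → ℝ → Fin 4 → ℝ) (u v : ℝ) : Fin 4 → ℝ := deriv (fun t => P t v) u

/-- The partial derivative with respect to the second variable. -/
def partialV (P : ℝ → ℝ → Fin 4 → ℝ) (u v : ℝ) : Fin 4 → ℝ := deriv (fun t => P u t) v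

/-- The coefficient `E` of the first fundamental form. -/
def coeffE (P : ℝ → ℝ → Fin 4 → ℝ) (u v : ℝ) : ℝ := lorentz (partialU P u v) (partialU P u v)

/-- The coefficient `F` of the first fundamental form. -/
def coeffF (P : ℝ → ℝ → Fin 4 → ℝ) (u v : ℝ) : ℝ := lorentz (partialU P u v) (partialV P u v)

/-- The coefficient `G` of the first fundamental form. -/
def coeffG (P : ℝ → ℝ → Fin 4 → ℝ) (u v : ℝ) : ℝ := lorentz (partialV P u v) (partialV P u v)

/-- `P` is a space-like immersion at `(u, v)`: its first fundamental form is positive definite. -/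
def IsSpacelikeAt (P : ℝ → ℝ → Fin 4 → ℝ) (u v : ℝ) : Prop :=
  0 < coeffE P u v ∧ 0 < coeffE P u v * coeffG P u v - coeffF P u v ^ 2

/-- `n` is a (time-like) unit normal vector in `S³₁` of the surface `P` in `S³₁` at `(u, v)`. -/
def IsUnitNormalAt (P : ℝ → ℝ → Fin 4 → ℝ) (n : Fin 4 → ℝ) (u v : ℝ) : Prop :=
  lorentz n n = -1 ∧ lorentz n (P u v) = 0 ∧
    lorentz n (partialU P u v) = 0 ∧ lorentz n (partialV P u v) = 0

/-- The mean curvature `(E N - 2 F M + G L) / (2 (E G - F²))` at `(u, v)` of a space-like surface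
`P` in `S³₁`, with respect to the unit normal vector `n`. -/
def meanCurvature (P : ℝ → ℝ → Fin 4 → ℝ) (n : Fin 4 → ℝ) (u v : ℝ) : ℝ :=
  (coeffE P u v * lorentz (partialV (partialV P) u v) n
      - 2 * coeffF P u v * lorentz (partialV (partialU P) u v) n
      + coeffG P u v * lorentz (partialU (partialU P) u v) n)
    / (2 * (coeffE P u v * coeffG P u v - coeffF P u v ^ 2))

/-- The point `(t cos θ, t sin θ, t)` of the 2-dimensional double cone. For `t ≠ 0` this map is a
real analytic local diffeomorphism onto the double cone without its vertex. -/
def conePolar (t θ : ℝ) : doubleCone 2 :=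
  ⟨![t * Real.cos θ, t * Real.sin θ, t], by
    change ∑ j : Fin 2, _ = _
    rw [Fin.sum_univ_two]
    change (t * Real.cos θ) ^ 2 + (t * Real.sin θ) ^ 2 = t ^ 2
    nlinarith [Real.sin_sq_add_cos_sq θ]⟩

/-- Real analytic space-like CMC-1 DC-immersions of a connected 2-dimensional DC-manifold `X`
into `S³₁`: off the DC-points, the map is a space-like immersion whose mean curvature is `1` with
respect to a continuous unit normal field. The local parametrizations
`(t, θ) ↦ φ⁻¹ (t cos θ, t sin θ, t)`, `t ≠ 0`, for the charts `φ`, are used as coordinates on the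
complement of the DC-points. -/
def DCStructure.IsSpacelikeCMC1DCImmersion {X : Type*} [TopologicalSpace X]
    (D : DCStructure 2 X) (f : X → deSitter3) : Prop :=
  ConnectedSpace X ∧ D.IsDCImmersion 3 f ∧
    ∃ n : X → Fin 4 → ℝ, ContinuousOn n (D.dcPoints)ᶜ ∧
      ∀ φ ∈ D.charts, ∀ t θ : ℝ, t ≠ 0 → conePolar t θ ∈ φ.target →
        let P : ℝ → ℝ → Fin 4 → ℝ := fun u v => f (φ.symm (conePolar u v))
        IsSpacelikeAt P t θ ∧
        IsUnitNormalAt P (n (φ.symm (conePolar t θ))) t θ ∧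
        meanCurvature P (n (φ.symm (conePolar t θ))) t θ = 1

/-! ## The G-catenoids of type TH -/

namespace CatenoidTH

/-- The component `x₀(s)`. -/
def x₀ (ν s : ℝ) : ℝ :=
  Real.sin s * Real.sinh (s / ν) - (ν ^ 2 - 1) * Real.cos s * Real.cosh (s / ν) / (2 * ν)

/-- The component `x₃(s)`. -/
def x₃ (ν s : ℝ) : ℝ :=
  Real.sin s * Real.cosh (s / ν) - (ν ^ 2 - 1) * Real.cos s * Real.sinh (s / ν) / (2 * ν)

/-- The radius function of the profile curve `(x₀(s), radius(s), 0, x₃(s))`. -/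
def radius (ν s : ℝ) : ℝ := (ν ^ 2 + 1) / (2 * ν) * Real.cos s

/-- The surface `ξ² + η² = (1 + ν²)² cos² s / (4 ν²)` in `ℝ³ ∋ (ξ, η, s)`. -/
def X (ν : ℝ) : Set (Fin 3 → ℝ) :=
  {p | p 0 ^ 2 + p 1 ^ 2 = (1 + ν ^ 2) ^ 2 * Real.cos (p 2) ^ 2 / (4 * ν ^ 2)}

theorem radius_sq (ν s : ℝ) :
    radius ν s ^ 2 = (1 + ν ^ 2) ^ 2 * Real.cos s ^ 2 / (4 * ν ^ 2) := by
  unfold radius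
  rw [mul_pow, div_pow]
  ring

theorem mem_deSitter3 {ν : ℝ} (hν : 0 < ν) {ξ η s : ℝ}
    (h : ξ ^ 2 + η ^ 2 = (1 + ν ^ 2) ^ 2 * Real.cos s ^ 2 / (4 * ν ^ 2)) :
    ![x₀ ν s, ξ, η, x₃ ν s] ∈ deSitter3 := by
  change -(x₀ ν s * x₀ ν s) + ξ * ξ + η * η + x₃ ν s * x₃ ν s = 1
  have h1 : -(x₀ ν s * x₀ ν s) + ξ * ξ + η * η + x₃ ν s * x₃ ν s
      = (x₃ ν s ^ 2 - x₀ ν s ^ 2) + (ξ ^ 2 + η ^ 2) := by ring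
  have hc := Real.cosh_sq (s / ν)
  have hs := Real.sin_sq s
  have hd : x₃ ν s ^ 2 - x₀ ν s ^ 2
      = Real.sin s ^ 2 - ((ν ^ 2 - 1) / (2 * ν)) ^ 2 * Real.cos s ^ 2 := by
    unfold x₀ x₃
    linear_combination
      (Real.sin s ^ 2 - ((ν ^ 2 - 1) / (2 * ν)) ^ 2 * Real.cos s ^ 2) * hc
  rw [h1, hd, h, hs]
  field_simp
  ring

/-- The map `(ξ, η, s) ↦ (x₀(s), ξ, η, x₃(s))`. -/
def fTilde {ν : ℝ} (hν : 0 < ν) (p : X ν) : deSitter3 :=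
  ⟨![x₀ ν (p.1 2), p.1 0, p.1 1, x₃ ν (p.1 2)], mem_deSitter3 hν p.2⟩

theorem rotation_sq (ν s : ℝ) (θ : Real.Angle) :
    (radius ν s * θ.cos) ^ 2 + (radius ν s * θ.sin) ^ 2
      = (1 + ν ^ 2) ^ 2 * Real.cos s ^ 2 / (4 * ν ^ 2) := by
  rw [← radius_sq]
  linear_combination radius ν s ^ 2 * θ.cos_sq_add_sin_sq

/-- The map `(s, θ) ↦ (x₁(s,θ), x₂(s,θ), s)` from `ℝ × T¹`, `T¹ = ℝ/2πℤ`. -/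
def param (ν : ℝ) (q : ℝ × Real.Angle) : X ν :=
  ⟨![radius ν q.1 * q.2.cos, radius ν q.1 * q.2.sin, q.1], rotation_sq ν q.1 q.2⟩

/-- The G-catenoid of type TH, `ℝ × T¹ → S³₁`: the profile curve `(x₀(s), radius(s), 0, x₃(s))`
rotated by the angle `θ` in the `x₁x₂`-plane. -/
def f {ν : ℝ} (hν : 0 < ν) (q : ℝ × Real.Angle) : deSitter3 :=
  ⟨![x₀ ν q.1, radius ν q.1 * q.2.cos, radius ν q.1 * q.2.sin, x₃ ν q.1],
    mem_deSitter3 hν (rotation_sq ν q.1 q.2)⟩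

/-- The inclusion of the surface `X` into `ℝ³`. -/
def incl (ν : ℝ) (p : X ν) : (univ : Set (Fin 3 → ℝ)) := ⟨p, mem_univ _⟩

end CatenoidTH

end

/-! Charts. Near a zero `node k` of `cos`, `cos (node k + z) = ± z * sinc z`. Dividing `ξ, η` by
`amp ν * sinc z` therefore turns the equation of `X` into that of the cone, as long as `|z| < π`.
These charts are restrictions of bianalytic maps of open sets of `ℝ³`, so their transition maps are
analytic and the inclusion is a DC-immersion. An analytic diffeomorphism between open parts of the
cone that is defined at the vertex fixes it, so the DC-points are exactly the nodes
(`mem_dcPoints`).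

Immersion. On de Sitter space `(x₃ + x₀)(x₃ - x₀) = 1 - x₁² - x₂²`, so `(x₁, x₂, x₃ + δ x₀)` with `δ
= ±1` are coordinates wherever the last one is nonzero. Since `ν ≠ 1`, at each point of the surface
some `δ` works. In these coordinates `fTilde` is `(ξ, η, g s)`. Adding a multiple of the defining
function of `X` changes nothing on `X` and makes the map a local diffeomorphism of `ℝ³`
(`exists_deriv_ne_zero`). The mean curvature is a computation in an orthonormal frame that moves
with the boost and the rotation.

Completeness. The de Sitter equation determines `x₁² + x₂²` from `(x₀, x₃)`, so a point of `S³₁` is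
in the image iff its `(x₀, x₃)` lies on the profile curve, which is an immersed analytic plane
curve. At the nodes `|x₃| = cosh (s / ν)`, so the profile leaves every bounded set frequently at
both ends. A bounded analytic curve starting in the profile meets one compact arc infinitely often,
with the ends of the arc out of reach. Straightening the arc locally and applying the identity
theorem propagates membership along `[0, 1]`.

Properness. The same nodes are barriers: along a curve whose image stays bounded, `s` cannot pass
far nodes, so it stays in a compact slab. Yet between the nodes the profile returns to a bounded
region for arbitrarily large `s`, because `x₃ + x₀` vanishes there and `x₃ = sin s * exp (-s / ν)`.
Hence arc-properness holds and properness fails. -/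

noncomputable section

/-! ## Analytic partial homeomorphisms and the charts they induce on subsets -/

/-- A partial homeomorphism between normed spaces that is real analytic in both directions. -/
def OpenPartialHomeomorph.IsBianalytic {E F : Type*} [NormedAddCommGroup E] [NormedSpace ℝ E]
    [NormedAddCommGroup F] [NormedSpace ℝ F] (A : OpenPartialHomeomorph E F) : Prop :=
  AnalyticOnNhd ℝ A A.source ∧ AnalyticOnNhd ℝ A.symm A.target

namespace OpenPartialHomeomorph

section induced

variable {E F : Type*} [TopologicalSpace E] [TopologicalSpace F]

open Classical in
/-- The partial homeomorphism between subsets `S` and `T` induced by an ambient partial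
homeomorphism that maps `S` to `T`. -/
def induced (A : OpenPartialHomeomorph E F) {S : Set E} {T : Set F}
    (h : ∀ x ∈ A.source, x ∈ S ↔ A x ∈ T) (s₀ : S) (t₀ : T) : OpenPartialHomeomorph S T where
  -- Off the source and target the values need not lie in `T` or `S`; `t₀` and `s₀` are default
  -- values there.
  toFun x := if hx : A x ∈ T then ⟨A x, hx⟩ else t₀
  invFun y := if hy : A.symm y ∈ S then ⟨A.symm y, hy⟩ else s₀
  source := Subtype.val ⁻¹' A.source
  target := Subtype.val ⁻¹' A.target
  map_source' := by
    intro x hx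
    have := (h x hx).1 x.2
    simpa [this] using A.map_source hx
  map_target' := by
    intro y hy
    have hs := A.map_target hy
    have : A.symm y ∈ S := (h _ hs).2 (by rw [A.right_inv hy]; exact y.2)
    simpa [this] using hs
  left_inv' := by
    intro x hx
    have h1 := (h x hx).1 x.2
    have h2 := A.left_inv hx
    apply Subtype.ext
    simp [h1, h2]
  right_inv' := by
    intro y hy
    have hs := A.map_target hy
    have h2 := A.right_inv hy
    have h1 : A.symm y ∈ S := (h _ hs).2 (by rw [h2]; exact y.2)
    apply Subtype.ext
    simp [h1, h2]
  open_source := A.open_source.preimage continuous_subtype_val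
  open_target := A.open_target.preimage continuous_subtype_val
  continuousOn_toFun := by
    rw [continuousOn_iff_continuous_domRestrict]
    refine Continuous.subtype_mk
      (f := fun x : (Subtype.val ⁻¹' A.source : Set S) => A (x : S)) ?_
      (fun x => (h _ x.2).1 x.1.2) |>.congr ?_
    · exact A.continuousOn.comp_continuous (by fun_prop) (fun x => x.2)
    · intro x
      have h1 := (h _ x.2).1 x.1.2
      simp [h1]
  continuousOn_invFun := by
    rw [continuousOn_iff_continuous_domRestrict]
    have key : ∀ y : (Subtype.val ⁻¹' A.target : Set T), A.symm (y : T) ∈ S := fun y =>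
      (h _ (A.map_target y.2)).2 (by rw [A.right_inv y.2]; exact y.1.2)
    refine Continuous.subtype_mk
      (f := fun y : (Subtype.val ⁻¹' A.target : Set T) => A.symm (y : T)) ?_ key |>.congr ?_
    · exact A.continuousOn_symm.comp_continuous (by fun_prop) (fun x => x.2)
    · intro y
      have h1 := key y
      simp [h1]

variable (A : OpenPartialHomeomorph E F) {S : Set E} {T : Set F}
    (h : ∀ x ∈ A.source, x ∈ S ↔ A x ∈ T) (s₀ : S) (t₀ : T)

@[simp] theorem induced_source : (A.induced h s₀ t₀).source = Subtype.val ⁻¹' A.source := rfl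

@[simp] theorem induced_target : (A.induced h s₀ t₀).target = Subtype.val ⁻¹' A.target := rfl

theorem induced_apply {x : S} (hx : A x ∈ T) : (A.induced h s₀ t₀ x : F) = A x := by
  classical
  have : (A.induced h s₀ t₀ x) = if hx : A x ∈ T then ⟨A x, hx⟩ else t₀ := rfl
  simp [this, hx]

theorem induced_apply_of_mem {x : S} (hx : (x : E) ∈ A.source) :
    (A.induced h s₀ t₀ x : F) = A x :=
  A.induced_apply h s₀ t₀ ((h x hx).1 x.2)

theorem induced_symm_apply {y : T} (hy : A.symm y ∈ S) :
    ((A.induced h s₀ t₀).symm y : E) = A.symm y := by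
  classical
  have : ((A.induced h s₀ t₀).symm y) = if hy : A.symm y ∈ S then ⟨A.symm y, hy⟩ else s₀ := rfl
  simp [this, hy]

theorem induced_symm_apply_of_mem {y : T} (hy : (y : F) ∈ A.target) :
    ((A.induced h s₀ t₀).symm y : E) = A.symm y :=
  A.induced_symm_apply h s₀ t₀
    ((h _ (A.map_target hy)).2 (by rw [A.right_inv hy]; exact y.2))

end induced

variable {E F G : Type*} [NormedAddCommGroup E] [NormedSpace ℝ E] [NormedAddCommGroup F]
  [NormedSpace ℝ F] [NormedAddCommGroup G] [NormedSpace ℝ G]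

theorem IsBianalytic.symm {A : OpenPartialHomeomorph E F} (hA : A.IsBianalytic) :
    A.symm.IsBianalytic := ⟨hA.2, hA.1⟩

theorem IsBianalytic.trans {A : OpenPartialHomeomorph E F} {B : OpenPartialHomeomorph F G}
    (hA : A.IsBianalytic) (hB : B.IsBianalytic) : (A.trans B).IsBianalytic := by
  constructor
  · intro x hx
    rw [OpenPartialHomeomorph.trans_source] at hx
    exact (hB.1 _ hx.2).comp (hA.1 _ hx.1)
  · intro x hx
    rw [OpenPartialHomeomorph.trans_target] at hx
    exact (hA.2 _ hx.2).comp (hB.2 _ hx.1)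

theorem IsBianalytic.restr {A : OpenPartialHomeomorph E F} (hA : A.IsBianalytic)
    {W : Set E} (hW : IsOpen W) : (A.restrOpen W hW).IsBianalytic := by
  constructor
  · intro x hx
    exact hA.1 _ hx.1
  · intro x hx
    exact hA.2 _ hx.1

/-- Transition maps between induced charts are real analytic. -/
theorem IsBianalytic.isAnalyticOnSubset_transition {A B : OpenPartialHomeomorph E F}
    (hA : A.IsBianalytic) (hB : B.IsBianalytic) {S : Set E} {T : Set F}
    (h : ∀ x ∈ A.source, x ∈ S ↔ A x ∈ T) (h' : ∀ x ∈ B.source, x ∈ S ↔ B x ∈ T)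
    (s₀ s₁ : S) (t₀ t₁ : T) :
    IsAnalyticOnSubset ((A.induced h s₀ t₀).symm.trans (B.induced h' s₁ t₁)).source
      (fun a => (B.induced h' s₁ t₁ ((A.induced h s₀ t₀).symm a) : F)) := by
  have hmem : ∀ a : T, a ∈ ((A.induced h s₀ t₀).symm.trans (B.induced h' s₁ t₁)).source ↔
      (a : F) ∈ (A.symm.trans B).source := by
    intro a
    simp only [trans_source, symm_source, induced_target, mem_inter_iff, mem_preimage,
      induced_source]
    refine and_congr_right fun ha => ?_
    rw [A.induced_symm_apply_of_mem h s₀ t₀ ha]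
  refine ⟨(A.symm.trans B).source, (A.symm.trans B).open_source, ?_, A.symm.trans B,
    (hA.symm.trans hB).1, ?_⟩
  · ext a
    exact (hmem a).symm
  · intro a ha
    have ha' := (hmem a).1 ha
    rw [trans_source] at ha'
    have e1 := A.induced_symm_apply_of_mem h s₀ t₀ ha'.1
    beta_reduce
    rw [B.induced_apply_of_mem h' s₁ t₁ (by rw [e1]; exact ha'.2), e1]
    rfl

/-- A real analytic map between finite-dimensional spaces with injective derivative at a point is
a bianalytic partial homeomorphism between small neighbourhoods. -/
theorem exists_isBianalytic [FiniteDimensional ℝ E] [FiniteDimensional ℝ F]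
    (hd : Module.finrank ℝ E = Module.finrank ℝ F) {f : E → F} {a : E}
    {f' : E →L[ℝ] F} (hf : AnalyticAt ℝ f a)
    (hf' : HasFDerivAt f f' a) (hinj : Function.Injective f') {W : Set E} (hW : W ∈ 𝓝 a) :
    ∃ A : OpenPartialHomeomorph E F, A.IsBianalytic ∧ a ∈ A.source ∧ A.source ⊆ W ∧
      ∀ x, A x = f x := by
  have : CompleteSpace E := FiniteDimensional.complete ℝ E
  have : CompleteSpace F := FiniteDimensional.complete ℝ F
  let e : E ≃L[ℝ] F :=
    (LinearEquiv.ofInjectiveOfFinrankEq (f' : E →ₗ[ℝ] F) hinj hd).toContinuousLinearEquiv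
  have he : (e : E →L[ℝ] F) = f' := by ext x; rfl
  have hs : HasStrictFDerivAt f (e : E →L[ℝ] F) a := by
    have := hf.hasStrictFDerivAt
    rwa [hf'.fderiv, ← he] at this
  let A₀ := hs.toOpenPartialHomeomorph f
  have hA₀ : ∀ x, A₀ x = f x := fun x => rfl
  have ha₀ : a ∈ A₀.source := hs.mem_toOpenPartialHomeomorph_source
  have hsymm : AnalyticAt ℝ A₀.symm (f a) := by
    refine A₀.analyticAt_symm (i := e) (hs.image_mem_toOpenPartialHomeomorph_target) ?_ ?_
    · have : A₀.symm (f a) = a := A₀.left_inv ha₀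
      rw [this]; exact hf
    · have : A₀.symm (f a) = a := A₀.left_inv ha₀
      rw [this]; exact hs.hasFDerivAt.fderiv
  obtain ⟨W', hW'W, hW'o, haW'⟩ := mem_nhds_iff.1 hW
  -- Two shrinkings: the source to points of `W'` where `f` is analytic, then the target to points
  -- where the inverse is analytic.
  let B := A₀.restrOpen (W' ∩ {x | AnalyticAt ℝ f x}) (hW'o.inter (isOpen_analyticAt ℝ f))
  let C := (B.symm.restrOpen {y | AnalyticAt ℝ A₀.symm y} (isOpen_analyticAt ℝ _)).symm
  have haB : a ∈ B.source := ⟨ha₀, haW', hf⟩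
  have hsub : C.source ⊆ B.source := by
    intro x hx
    have h1 : C x ∈ C.target := C.map_source hx
    have h2 : C.symm (C x) = x := C.left_inv hx
    rw [← h2]
    exact B.map_target h1.1
  refine ⟨C, ⟨?_, ?_⟩, ?_, ?_, fun x => rfl⟩
  · intro x hx
    exact (hsub hx).2.2
  · intro y hy
    exact hy.2
  · have h1 : f a ∈ C.target := ⟨B.map_source haB, hsymm⟩
    have h2 : C.symm (f a) = a := B.left_inv haB
    rw [← h2]
    exact C.map_target h1
  · intro x hx
    exact hW'W (hsub hx).2.1

end OpenPartialHomeomorph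

/-- This is how the target coordinates for the regularity claims are built: a known coordinate
system followed by bianalytic maps of `ℝⁿ`. -/
theorem IsAnalyticCoordinate.trans {E : Type*} [NormedAddCommGroup E] [NormedSpace ℝ E]
    {N : Set E} {n : ℕ} {Φ : OpenPartialHomeomorph N (Fin n → ℝ)} (hΦ : IsAnalyticCoordinate Φ)
    {B : OpenPartialHomeomorph (Fin n → ℝ) (Fin n → ℝ)} (hB : B.IsBianalytic) :
    IsAnalyticCoordinate (Φ.trans B) := by
  obtain ⟨⟨Ω, hΩ, hΩs, g, hg, hgeq⟩, hsymm⟩ := hΦ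
  refine ⟨⟨Ω ∩ g ⁻¹' B.source, hg.continuousOn.isOpen_inter_preimage hΩ B.open_source, ?_,
    fun x => B (g x), ?_, ?_⟩, ?_⟩
  · ext x
    rw [OpenPartialHomeomorph.trans_source, ← hΩs]
    simp only [preimage_inter, mem_inter_iff, mem_preimage]
    refine and_congr_right fun hx => ?_
    rw [hgeq x (hΩs ▸ hx)]
  · intro x hx
    exact (hB.1 _ hx.2).comp (hg _ hx.1)
  · intro x hx
    rw [OpenPartialHomeomorph.trans_source] at hx
    beta_reduce
    rw [hgeq x hx.1]
    rfl
  · intro y hy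
    rw [OpenPartialHomeomorph.trans_target] at hy
    exact (hsymm _ hy.2).comp (hB.2 _ hy.1)


/-! ## The cone charts of the surface `X` -/

/-- At `0`, `sinc` is the difference quotient `dslope` of `sin`, whose power series is that of `sin`
shifted by one degree. -/
theorem Real.analyticAt_sinc (x : ℝ) : AnalyticAt ℝ Real.sinc x := by
  by_cases hx : x = 0
  · subst hx
    rw [Real.sinc_eq_dslope]
    obtain ⟨p, hp⟩ := (Real.analyticAt_sin (x := 0))
    exact hp.has_fpower_series_dslope_fslope.analyticAt
  · have h : (fun y => Real.sin y / y) =ᶠ[𝓝 x] Real.sinc := by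
      filter_upwards [isOpen_ne.mem_nhds hx] with y hy
      rw [Real.sinc_of_ne_zero hy]
    exact (Real.analyticAt_sin.div analyticAt_id hx).congr h

theorem Real.mul_sinc (x : ℝ) : x * Real.sinc x = Real.sin x := by
  by_cases hx : x = 0
  · simp [hx]
  · rw [Real.sinc_of_ne_zero hx]; field_simp

theorem Real.sinc_ne_zero {x : ℝ} (hx : |x| < Real.pi) : Real.sinc x ≠ 0 := by
  by_cases h0 : x = 0
  · simp [h0]
  · intro h
    have := Real.mul_sinc x
    rw [h, mul_zero] at this
    rw [abs_lt] at hx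
    exact h0 ((Real.sin_eq_zero_iff_of_lt_of_lt hx.1 hx.2).1 this.symm)

theorem exists_cos_sin_eq {x y : ℝ} (h : x ^ 2 + y ^ 2 = 1) :
    ∃ θ : ℝ, Real.cos θ = x ∧ Real.sin θ = y := by
  have hn : ‖(⟨x, y⟩ : ℂ)‖ = 1 := by
    rw [Complex.norm_def, Complex.normSq_mk, ← sq, ← sq, h, Real.sqrt_one]
  have h0 : (⟨x, y⟩ : ℂ) ≠ 0 := by
    intro h; rw [h] at hn; simp at hn
  refine ⟨Complex.arg ⟨x, y⟩, ?_, ?_⟩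
  · rw [Complex.cos_arg h0, hn, div_one]
  · rw [Complex.sin_arg, hn, div_one]

theorem exists_polar {x y r : ℝ} (h : x ^ 2 + y ^ 2 = r ^ 2) :
    ∃ θ : ℝ, x = r * Real.cos θ ∧ y = r * Real.sin θ := by
  by_cases hr : r = 0
  · subst hr
    refine ⟨0, ?_, ?_⟩ <;> nlinarith [sq_nonneg x, sq_nonneg y]
  · obtain ⟨θ, h1, h2⟩ := exists_cos_sin_eq (x := x / r) (y := y / r) (by
      field_simp; exact h)
    refine ⟨θ, ?_, ?_⟩
    · rw [h1]; field_simp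
    · rw [h2]; field_simp

theorem mem_doubleCone_two {a : Fin 3 → ℝ} :
    a ∈ doubleCone 2 ↔ a 0 ^ 2 + a 1 ^ 2 = a 2 ^ 2 := by
  change ∑ j : Fin 2, a j.castSucc ^ 2 = _ ↔ _
  rw [Fin.sum_univ_two]
  rfl

/-- The vertex of the double cone. -/
def coneVertex : doubleCone 2 := ⟨0, by rw [mem_doubleCone_two]; simp⟩

namespace CatenoidTH

/-- The maximal value of the radius function. -/
def amp (ν : ℝ) : ℝ := (ν ^ 2 + 1) / (2 * ν)

theorem amp_pos {ν : ℝ} (hν : 0 < ν) : 0 < amp ν := by unfold amp; positivity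

theorem mem_X {ν : ℝ} {p : Fin 3 → ℝ} :
    p ∈ X ν ↔ p 0 ^ 2 + p 1 ^ 2 = (amp ν * Real.cos (p 2)) ^ 2 := by
  have := radius_sq ν (p 2)
  unfold radius at this
  change p 0 ^ 2 + p 1 ^ 2 = _ ↔ _
  rw [← this, amp]

/-- The zeros of the radius function. -/
def node (k : ℤ) : ℝ := Real.pi / 2 + Real.pi * k

theorem cos_node_add (k : ℤ) (z : ℝ) :
    Real.cos (node k + z) = -((-1 : ℝ) ^ k * Real.sin z) := by
  have : node k + z = (z + k * Real.pi) + Real.pi / 2 := by unfold node; ring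
  rw [this, Real.cos_add_pi_div_two, Real.sin_add_int_mul_pi]

theorem sin_node_add (k : ℤ) (z : ℝ) :
    Real.sin (node k + z) = (-1 : ℝ) ^ k * Real.cos z := by
  have : node k + z = (z + k * Real.pi) + Real.pi / 2 := by unfold node; ring
  rw [this, Real.sin_add_pi_div_two, Real.cos_add_int_mul_pi]

theorem neg_one_zpow_sq (k : ℤ) : ((-1 : ℝ) ^ k) ^ 2 = 1 := by
  rw [← zpow_natCast, ← zpow_mul, mul_comm, zpow_mul]; simp

theorem cos_eq_zero_iff_node {s : ℝ} : Real.cos s = 0 ↔ ∃ k : ℤ, s = node k := by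
  rw [Real.cos_eq_zero_iff]
  refine exists_congr fun k => ?_
  unfold node
  constructor <;> intro h <;> rw [h] <;> ring

theorem exists_abs_sub_node_lt (s : ℝ) : ∃ k : ℤ, |s - node k| < Real.pi := by
  have hpi := Real.pi_pos
  -- This index gives `s - node k ∈ [-π/2, π/2)`.
  refine ⟨⌊s / Real.pi⌋, ?_⟩
  have h1 := Int.floor_le (s / Real.pi)
  have h2 := Int.lt_floor_add_one (s / Real.pi)
  rw [le_div_iff₀ hpi] at h1
  rw [div_lt_iff₀ hpi] at h2
  unfold node
  rw [abs_lt]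
  constructor <;> nlinarith

/-- The ambient version of the cone chart at the node `node k`. -/
def ambientChart {ν : ℝ} (hν : 0 < ν) (k : ℤ) :
    OpenPartialHomeomorph (Fin 3 → ℝ) (Fin 3 → ℝ) where
  -- With `z = p 2 - node k`, the radius `amp ν * cos (p 2)` is `± amp ν * sinc z * z`. The chart
  -- reaches up to the two neighbouring nodes, where `sinc z` first vanishes.
  toFun p := ![p 0 / (amp ν * Real.sinc (p 2 - node k)),
    p 1 / (amp ν * Real.sinc (p 2 - node k)), p 2 - node k]
  invFun a := ![amp ν * Real.sinc (a 2) * a 0, amp ν * Real.sinc (a 2) * a 1, node k + a 2]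
  source := {p | |p 2 - node k| < Real.pi}
  target := {a | |a 2| < Real.pi}
  map_source' p hp := hp
  map_target' a ha := by simpa using ha
  left_inv' p hp := by
    have h1 := Real.sinc_ne_zero hp
    have h2 := (amp_pos hν).ne'
    ext i; fin_cases i <;> simp <;> field_simp
  right_inv' a ha := by
    have h1 := Real.sinc_ne_zero ha
    have h2 := (amp_pos hν).ne'
    ext i; fin_cases i <;> simp <;> field_simp
  open_source := isOpen_lt (by fun_prop) continuous_const
  open_target := isOpen_lt (by fun_prop) continuous_const
  continuousOn_toFun := by
    have hs := Real.continuous_sinc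
    refine continuousOn_pi.2 fun i => ?_
    have hne : ∀ p ∈ {p : Fin 3 → ℝ | |p 2 - node k| < Real.pi},
        amp ν * Real.sinc (p 2 - node k) ≠ 0 :=
      fun p hp => mul_ne_zero (amp_pos hν).ne' (Real.sinc_ne_zero hp)
    fin_cases i
    · exact ContinuousOn.div (by fun_prop) (by fun_prop) hne
    · exact ContinuousOn.div (by fun_prop) (by fun_prop) hne
    · exact Continuous.continuousOn (f := fun p : Fin 3 → ℝ => p 2 - node k) (by fun_prop)
  continuousOn_invFun := by
    have hs := Real.continuous_sinc
    refine continuousOn_pi.2 fun i => ?_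
    fin_cases i <;> simp <;> fun_prop

variable {ν : ℝ} (hν : 0 < ν) (k : ℤ)

theorem ambientChart_apply (p : Fin 3 → ℝ) : ambientChart hν k p =
    ![p 0 / (amp ν * Real.sinc (p 2 - node k)),
    p 1 / (amp ν * Real.sinc (p 2 - node k)), p 2 - node k] := rfl

theorem ambientChart_symm_apply (a : Fin 3 → ℝ) : (ambientChart hν k).symm a =
    ![amp ν * Real.sinc (a 2) * a 0, amp ν * Real.sinc (a 2) * a 1, node k + a 2] := rfl

theorem ambientChart_symm_mem {a : Fin 3 → ℝ} (ha : a ∈ doubleCone 2) :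
    (ambientChart hν k).symm a ∈ X ν := by
  rw [mem_doubleCone_two] at ha
  rw [mem_X, ambientChart_symm_apply]
  simp only [Matrix.cons_val]
  rw [cos_node_add, ← Real.mul_sinc]
  linear_combination (amp ν * Real.sinc (a 2)) ^ 2 * ha -
    (amp ν * (a 2 * Real.sinc (a 2))) ^ 2 * neg_one_zpow_sq k

theorem ambientChart_mem_iff (p : Fin 3 → ℝ) (hp : p ∈ (ambientChart hν k).source) :
    p ∈ X ν ↔ ambientChart hν k p ∈ doubleCone 2 := by
  refine ⟨fun h => ?_, fun h => ?_⟩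
  · rw [mem_X] at h
    have e : p 2 = node k + (p 2 - node k) := by ring
    rw [e, cos_node_add, ← Real.mul_sinc] at h
    have h1 := Real.sinc_ne_zero (show |p 2 - node k| < Real.pi from hp)
    have h2 := (amp_pos hν).ne'
    rw [mem_doubleCone_two, ambientChart_apply]
    simp only [Matrix.cons_val]
    rw [div_pow, div_pow, ← add_div, div_eq_iff (by positivity), h]
    linear_combination (amp ν * ((p 2 - node k) * Real.sinc (p 2 - node k))) ^ 2 *
      neg_one_zpow_sq k
  · rw [← (ambientChart hν k).left_inv hp]
    exact ambientChart_symm_mem hν k h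

theorem ambientChart_isBianalytic : (ambientChart hν k).IsBianalytic := by
  have hpr : ∀ (i : Fin 3) (p : Fin 3 → ℝ), AnalyticAt ℝ (fun p : Fin 3 → ℝ => p i) p :=
    fun i p => (ContinuousLinearMap.proj (R := ℝ) (φ := fun _ : Fin 3 => ℝ) i).analyticAt p
  constructor
  · intro p hp
    have hp' : |p 2 - node k| < Real.pi := hp
    have hs : AnalyticAt ℝ (fun p : Fin 3 → ℝ => p 2 - node k) p :=
      (hpr 2 p).sub analyticAt_const
    have hg : AnalyticAt ℝ (fun p : Fin 3 → ℝ => amp ν * Real.sinc (p 2 - node k)) p :=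
      analyticAt_const.mul ((Real.analyticAt_sinc _).comp hs)
    have hne := mul_ne_zero (amp_pos hν).ne' (Real.sinc_ne_zero hp')
    refine AnalyticAt.pi fun i => ?_
    fin_cases i
    · exact (hpr 0 p).div hg hne
    · exact (hpr 1 p).div hg hne
    · exact hs
  · intro a _
    have hg : AnalyticAt ℝ (fun a : Fin 3 → ℝ => amp ν * Real.sinc (a 2)) a :=
      analyticAt_const.mul ((Real.analyticAt_sinc _).comp (hpr 2 a))
    refine AnalyticAt.pi fun i => ?_
    fin_cases i
    · exact hg.mul (hpr 0 a)
    · exact hg.mul (hpr 1 a)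
    · exact analyticAt_const.add (hpr 2 a)

/-- A point of `X`. -/
def basePoint (ν : ℝ) : X ν := param ν (0, 0)

/-- The cone chart of `X` at the node `node k`. -/
def chart : OpenPartialHomeomorph (X ν) (doubleCone 2) :=
  (ambientChart hν k).induced (ambientChart_mem_iff hν k) (basePoint ν) coneVertex

theorem chart_symm_apply (a : doubleCone 2) :
    ((chart hν k).symm a : Fin 3 → ℝ) = (ambientChart hν k).symm a :=
  OpenPartialHomeomorph.induced_symm_apply _ _ _ _ (ambientChart_symm_mem hν k a.2)

theorem chart_apply {p : X ν} (hp : p ∈ (chart hν k).source) :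
    (chart hν k p : Fin 3 → ℝ) = ambientChart hν k p :=
  OpenPartialHomeomorph.induced_apply_of_mem _ _ _ _ hp

/-- The target is star-shaped about the vertex, the cone being invariant under scaling. -/
theorem isConnected_chart_target : IsConnected (chart hν k).target := by
  have h0 : coneVertex ∈ (chart hν k).target := by
    change |(0 : ℝ)| < _
    simpa using Real.pi_pos
  refine ⟨⟨_, h0⟩, isPreconnected_of_forall coneVertex fun a ha => ?_⟩
  have hmem : ∀ t : ℝ, t • (a : Fin 3 → ℝ) ∈ doubleCone 2 := by
    intro t
    have := mem_doubleCone_two.1 a.2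
    rw [mem_doubleCone_two]
    simp only [Pi.smul_apply, smul_eq_mul]
    linear_combination t ^ 2 * this
  refine ⟨(fun t : ℝ => (⟨t • (a : Fin 3 → ℝ), hmem t⟩ : doubleCone 2)) '' Icc 0 1, ?_, ?_, ?_, ?_⟩
  · rintro _ ⟨t, ht, rfl⟩
    have ha' : |a.1 2| < Real.pi := ha
    change |t * a.1 2| < Real.pi
    rw [abs_mul, abs_of_nonneg ht.1]
    exact (mul_le_of_le_one_left (abs_nonneg _) ht.2).trans_lt ha'
  · exact ⟨0, by simp, Subtype.ext (by simp [coneVertex])⟩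
  · exact ⟨1, by simp, Subtype.ext (by simp)⟩
  · refine isPreconnected_Icc.image _ (Continuous.continuousOn ?_)
    exact Continuous.subtype_mk (by fun_prop) _

theorem isClosed_X (ν : ℝ) : IsClosed (X ν) :=
  isClosed_eq (by fun_prop) (by fun_prop)

/-- The DC-manifold structure of `X`. -/
def dcStructure : DCStructure 2 (X ν) where
  t2 := inferInstance
  locallyCompact := (isClosed_X ν).isClosedEmbedding_subtypeVal.locallyCompactSpace
  secondCountable := inferInstance
  charts := range (chart hν)
  covers x := by
    obtain ⟨k, hk⟩ := exists_abs_sub_node_lt (x.1 2)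
    exact ⟨_, ⟨k, rfl⟩, hk⟩
  connected := by
    rintro _ ⟨k, rfl⟩
    exact isConnected_chart_target hν k
  compatible := by
    rintro _ ⟨k, rfl⟩ _ ⟨l, rfl⟩
    exact (ambientChart_isBianalytic hν k).isAnalyticOnSubset_transition
      (ambientChart_isBianalytic hν l) _ _ _ _ _ _

/-- Charts induced by bianalytic ambient maps are local DC-coordinate systems. -/
theorem isLocalCoordinate_induced {A : OpenPartialHomeomorph (Fin 3 → ℝ) (Fin 3 → ℝ)}
    (hA : A.IsBianalytic) (h : ∀ p ∈ A.source, p ∈ X ν ↔ A p ∈ doubleCone 2) :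
    (dcStructure hν).IsLocalCoordinate (A.induced h (basePoint ν) coneVertex) := by
  rintro _ ⟨k, rfl⟩
  exact ⟨hA.isAnalyticOnSubset_transition (ambientChart_isBianalytic hν k) _ _ _ _ _ _,
    (ambientChart_isBianalytic hν k).isAnalyticOnSubset_transition hA _ _ _ _ _ _⟩

theorem isLocalCoordinate_chart : (dcStructure hν).IsLocalCoordinate (chart hν k) :=
  isLocalCoordinate_induced hν (ambientChart_isBianalytic hν k) _

/-! ### Polar parametrization and connectedness of the surface -/

theorem continuous_radius (ν : ℝ) : Continuous (radius ν) := by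
  unfold radius; fun_prop

theorem continuous_param (ν : ℝ) : Continuous (param ν) := by
  have := continuous_radius ν
  refine Continuous.subtype_mk (continuous_pi fun i => ?_) _
  fin_cases i <;> simp
  · exact (this.comp continuous_fst).mul (Real.Angle.continuous_cos.comp continuous_snd)
  · exact (this.comp continuous_fst).mul (Real.Angle.continuous_sin.comp continuous_snd)
  · fun_prop

theorem surjective_param (ν : ℝ) : Function.Surjective (param ν) := by
  intro p
  obtain ⟨θ, h1, h2⟩ := exists_polar (mem_X.1 p.2)
  refine ⟨(p.1 2, (θ : Real.Angle)), Subtype.ext ?_⟩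
  ext i
  fin_cases i
  · simpa [param, radius, amp] using h1.symm
  · simpa [param, radius, amp] using h2.symm
  · simp [param]

theorem connectedSpace_X (ν : ℝ) : ConnectedSpace (X ν) := by
  have : ConnectedSpace Real.Angle := by
    refine Function.Surjective.connectedSpace (f := ((↑) : ℝ → Real.Angle)) ?_
      Real.Angle.continuous_coe
    exact fun x => Quotient.exists_rep x
  exact (surjective_param ν).connectedSpace (continuous_param ν)

end CatenoidTH


/-! ## The DC-points -/

/-- The cone contains a basis of `ℝ³`. -/
theorem linearMap_ext_doubleCone {M : Type*} [AddCommGroup M] [Module ℝ M]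
    {f g : (Fin 3 → ℝ) →ₗ[ℝ] M} (h : ∀ v ∈ doubleCone 2, f v = g v) : f = g := by
  refine LinearMap.ext fun v => ?_
  have h1 := h ![1, 0, 1] (by rw [mem_doubleCone_two]; simp)
  have h2 := h ![1, 0, -1] (by rw [mem_doubleCone_two]; simp)
  have h3 := h ![0, 1, 1] (by rw [mem_doubleCone_two]; simp)
  have e : v = ((v 0 + v 2 - v 1) / 2) • ![1, 0, 1] + ((v 0 - v 2 + v 1) / 2) • ![1, 0, -1]
      + v 1 • ![0, 1, 1] := by
    ext i; fin_cases i <;> simp <;> ring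
  rw [e]
  simp only [map_add, map_smul, h1, h2, h3]

/-- A local diffeomorphism of the double cone that is defined at the vertex fixes the vertex. -/
theorem eq_zero_of_doubleCone_diffeo {G H : (Fin 3 → ℝ) → Fin 3 → ℝ}
    (hH : DifferentiableAt ℝ H 0) (hG : DifferentiableAt ℝ G (H 0))
    (h : ∀ v ∈ doubleCone 2, ∀ᶠ t : ℝ in 𝓝 0, H (t • v) ∈ doubleCone 2 ∧ G (H (t • v)) = t • v) :
    H 0 = 0 := by
  set H' := fderiv ℝ H 0 with hH'
  set G' := fderiv ℝ G (H 0) with hG'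
  have hline : ∀ v : Fin 3 → ℝ, HasDerivAt (fun t : ℝ => H (t • v)) (H' v) 0 := by
    intro v
    have h1 : HasDerivAt (fun t : ℝ => t • v) v 0 := by
      simpa using (hasDerivAt_id (0 : ℝ)).smul_const v
    have h2 : HasFDerivAt H H' ((0 : ℝ) • v) := by rw [zero_smul]; exact hH.hasFDerivAt
    exact h2.comp_hasDerivAt (0 : ℝ) h1
  -- Differentiating `G (H (t • v)) = t • v` along the lines of the cone gives `G' (H' v) = v` on
  -- the cone, hence everywhere; so `H'` is invertible.
  have hcomp : (G' : (Fin 3 → ℝ) →ₗ[ℝ] Fin 3 → ℝ) ∘ₗ (H' : (Fin 3 → ℝ) →ₗ[ℝ] Fin 3 → ℝ)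
      = LinearMap.id := by
    refine linearMap_ext_doubleCone fun v hv => ?_
    have h1 : HasFDerivAt G G' (H ((0 : ℝ) • v)) := by rw [zero_smul]; exact hG.hasFDerivAt
    have h2 : HasDerivAt (fun t : ℝ => G (H (t • v))) (G' (H' v)) 0 :=
      h1.comp_hasDerivAt (0 : ℝ) (hline v)
    have h3 : HasDerivAt (fun t : ℝ => t • v) v 0 := by
      simpa using (hasDerivAt_id (0 : ℝ)).smul_const v
    have h4 : HasDerivAt (fun t : ℝ => G (H (t • v))) v 0 :=
      h3.congr_of_eventuallyEq ((h v hv).mono fun t ht => ht.2)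
    exact h2.unique h4
  have hsurj : Function.Surjective (H' : (Fin 3 → ℝ) →ₗ[ℝ] Fin 3 → ℝ) := by
    rw [← LinearMap.injective_iff_surjective]
    exact Function.LeftInverse.injective (g := G') fun v => LinearMap.congr_fun hcomp v
  let pr : Fin 3 → (Fin 3 → ℝ) →ₗ[ℝ] ℝ := fun i => LinearMap.proj i
  -- Differentiating the cone equation for `H (t • v)` at `t = 0` shows that half the gradient of
  -- the quadratic form at `H 0` annihilates `H' v`. As `H'` is onto, this linear form is zero,
  -- which means `H 0 = 0`.
  have hq : (H 0 0 • pr 0 + H 0 1 • pr 1 - H 0 2 • pr 2) ∘ₗ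
      (H' : (Fin 3 → ℝ) →ₗ[ℝ] Fin 3 → ℝ) = 0 := by
    refine linearMap_ext_doubleCone fun v hv => ?_
    have hc := hasDerivAt_pi.1 (hline v)
    have h1 := (((hc 0).pow 2).add ((hc 1).pow 2)).sub ((hc 2).pow 2)
    have h2 : HasDerivAt (fun _ : ℝ => (0 : ℝ)) 0 0 := hasDerivAt_const _ _
    have h3 := h1.unique (h2.congr_of_eventuallyEq ((h v hv).mono fun t ht => by
      have := mem_doubleCone_two.1 ht.1
      simp only [Pi.add_apply, Pi.sub_apply, Pi.pow_apply]
      linarith))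
    simp only [zero_smul] at h3
    simp [pr]
    norm_num at h3
    linarith
  have hℓ : ∀ w : Fin 3 → ℝ, H 0 0 * w 0 + H 0 1 * w 1 - H 0 2 * w 2 = 0 := by
    intro w
    obtain ⟨v, rfl⟩ := hsurj w
    simpa [pr] using LinearMap.congr_fun hq v
  have h0 := hℓ ![1, 0, 0]
  have h1 := hℓ ![0, 1, 0]
  have h2 := hℓ ![0, 0, 1]
  simp at h0 h1 h2
  ext i; fin_cases i <;> simp [h0, h1, h2]

namespace CatenoidTH

variable {ν : ℝ} (hν : 0 < ν)

/-- An arbitrary local coordinate `ψ` with `ψ p = 0` is compared with a cone chart: the transition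
map is a diffeomorphism of the cone defined at the vertex, so the cone chart also sends `p` to the
vertex. -/
theorem mem_dcPoints {p : X ν} : p ∈ (dcStructure hν).dcPoints ↔ Real.cos (p.1 2) = 0 := by
  constructor
  · rintro ⟨ψ, hψ, hp, hp0⟩
    obtain ⟨k, hk⟩ := exists_abs_sub_node_lt (p.1 2)
    have hk' : p ∈ (chart hν k).source := hk
    set φ := chart hν k with hφ
    obtain ⟨⟨ΩH, hΩH, hΩHs, H, hH, hHeq⟩, ⟨ΩG, hΩG, hΩGs, G, hG, hGeq⟩⟩ := hψ φ ⟨k, rfl⟩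
    have hmem : ψ p ∈ (ψ.symm.trans φ).source := by
      rw [OpenPartialHomeomorph.trans_source]
      refine ⟨ψ.map_source hp, ?_⟩
      rw [mem_preimage, ψ.left_inv hp]
      exact hk'
    have hH0 : H 0 = φ p := by
      rw [← hp0, hHeq _ hmem]
      beta_reduce
      rw [ψ.left_inv hp]
    have h0Ω : (0 : Fin 3 → ℝ) ∈ ΩH := by
      rw [← hΩHs] at hmem
      rwa [mem_preimage, hp0] at hmem
    have hφmem : φ p ∈ (φ.symm.trans ψ).source := by
      rw [OpenPartialHomeomorph.trans_source]
      refine ⟨φ.map_source hk', ?_⟩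
      rw [mem_preimage, φ.left_inv hk']
      exact hp
    have hφΩ : H 0 ∈ ΩG := by
      rw [hH0]
      rwa [← hΩGs] at hφmem
    have hzero := eq_zero_of_doubleCone_diffeo (hH 0 h0Ω).differentiableAt
      (hG _ hφΩ).differentiableAt (fun v hv => by
        have hcont : Continuous fun t : ℝ => t • v := by fun_prop
        have hev : ∀ᶠ t : ℝ in 𝓝 0, t • v ∈ ΩH :=
          hcont.continuousAt.eventually_mem (hΩH.mem_nhds (by simpa using h0Ω))
        filter_upwards [hev] with t ht
        have htv : t • v ∈ doubleCone 2 := by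
          rw [mem_doubleCone_two] at hv ⊢
          simp only [Pi.smul_apply, smul_eq_mul]
          linear_combination t ^ 2 * hv
        have hb : (⟨t • v, htv⟩ : doubleCone 2) ∈ (ψ.symm.trans φ).source := by
          rw [← hΩHs]; exact ht
        have e1 : H (t • v) = φ (ψ.symm ⟨t • v, htv⟩) := hHeq ⟨t • v, htv⟩ hb
        rw [OpenPartialHomeomorph.trans_source] at hb
        have hc : φ (ψ.symm ⟨t • v, htv⟩) ∈ (φ.symm.trans ψ).source := by
          rw [OpenPartialHomeomorph.trans_source]
          refine ⟨φ.map_source hb.2, ?_⟩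
          rw [mem_preimage, φ.left_inv hb.2]
          exact ψ.map_target hb.1
        rw [e1]
        refine ⟨Subtype.coe_prop _, ?_⟩
        rw [hGeq _ hc]
        beta_reduce
        rw [φ.left_inv hb.2, ψ.right_inv hb.1])
    rw [hH0, hφ, chart_apply hν k hk', ambientChart_apply] at hzero
    have h2 := congrFun hzero 2
    simp at h2
    exact cos_eq_zero_iff_node.2 ⟨k, by linarith⟩
  · intro h
    obtain ⟨k, hk⟩ := cos_eq_zero_iff_node.1 h
    have hp : p ∈ (chart hν k).source := by
      change |p.1 2 - node k| < Real.pi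
      rw [hk]; simpa using Real.pi_pos
    refine ⟨chart hν k, isLocalCoordinate_chart hν k, hp, ?_⟩
    have hX := mem_X.1 p.2
    rw [h, mul_zero] at hX
    have h0 : p.1 0 = 0 := by nlinarith [sq_nonneg (p.1 0), sq_nonneg (p.1 1)]
    have h1 : p.1 1 = 0 := by nlinarith [sq_nonneg (p.1 0), sq_nonneg (p.1 1)]
    rw [chart_apply hν k hp, ambientChart_apply]
    ext i; fin_cases i <;> simp [h0, h1, hk]

theorem image_dcPoints : (Subtype.val '' (dcStructure hν).dcPoints : Set (Fin 3 → ℝ)) =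
    {p | ∃ k : ℤ, p = ![0, 0, Real.pi / 2 + Real.pi * k]} := by
  ext p
  constructor
  · rintro ⟨p, hp, rfl⟩
    rw [mem_dcPoints] at hp
    have hX := mem_X.1 p.2
    rw [hp, mul_zero] at hX
    have h0 : p.1 0 = 0 := by nlinarith [sq_nonneg (p.1 0), sq_nonneg (p.1 1)]
    have h1 : p.1 1 = 0 := by nlinarith [sq_nonneg (p.1 0), sq_nonneg (p.1 1)]
    obtain ⟨k, hk⟩ := cos_eq_zero_iff_node.1 hp
    refine ⟨k, ?_⟩
    ext i; fin_cases i
    · exact h0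
    · exact h1
    · exact hk
  · rintro ⟨k, rfl⟩
    have hc : Real.cos (Real.pi / 2 + Real.pi * k) = 0 := cos_eq_zero_iff_node.2 ⟨k, rfl⟩
    refine ⟨⟨![0, 0, Real.pi / 2 + Real.pi * k], ?_⟩, ?_, rfl⟩
    · rw [mem_X]; simp [hc]
    · rw [mem_dcPoints]; simpa using hc

theorem image_dcPoints_eq_range : (Subtype.val '' (dcStructure hν).dcPoints : Set (Fin 3 → ℝ)) =
    range fun k : ℤ => ![0, 0, Real.pi / 2 + Real.pi * k] := by
  rw [image_dcPoints]
  ext p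
  simp [eq_comm]

theorem countable_dcPoints : (dcStructure hν).dcPoints.Countable := by
  refine countable_of_injective_of_countable_image (f := Subtype.val)
    Subtype.val_injective.injOn ?_
  rw [image_dcPoints_eq_range]
  exact countable_range _

theorem infinite_dcPoints : (dcStructure hν).dcPoints.Infinite := by
  refine Infinite.of_image Subtype.val ?_
  rw [image_dcPoints_eq_range]
  refine infinite_range_of_injective fun k l h => ?_
  have := congrFun h 2
  simpa [Real.pi_ne_zero] using this

/-! ## The inclusion -/

theorem analyticAt_proj {n : ℕ} (i : Fin n) (p : Fin n → ℝ) :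
    AnalyticAt ℝ (fun p : Fin n → ℝ => p i) p :=
  (ContinuousLinearMap.proj (R := ℝ) (φ := fun _ : Fin n => ℝ) i).analyticAt p

/-- A map that extends to an analytic map on the ambient space is DC-analytic. -/
theorem isDCAnalytic_of_extends {E : Type*} [NormedAddCommGroup E] [NormedSpace ℝ E] {N : Set E}
    {g : X ν → N} {G : (Fin 3 → ℝ) → E} (hG : ∀ p, AnalyticAt ℝ G p)
    (h : ∀ p : X ν, (g p : E) = G p) :
    (dcStructure hν).IsDCAnalytic g := by
  rintro _ ⟨k, rfl⟩
  refine ⟨(ambientChart hν k).target, (ambientChart hν k).open_target, rfl,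
    fun a => G ((ambientChart hν k).symm a), fun a ha => ?_, fun a _ => ?_⟩
  · exact (hG _).comp ((ambientChart_isBianalytic hν k).2 a ha)
  · beta_reduce
    rw [h, chart_symm_apply]

/-- The ambient chart is itself a coordinate system of `ℝ³`, and in it the inclusion becomes the
identity. -/
theorem isDCImmersion_incl : (dcStructure hν).IsDCImmersion 3 (incl ν) := by
  refine ⟨by norm_num, isDCAnalytic_of_extends hν (G := id) (fun p => analyticAt_id) fun p => rfl,
    fun p => ?_⟩
  obtain ⟨k, hk⟩ := exists_abs_sub_node_lt (p.1 2)
  have hU : IsAnalyticCoordinate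
      (Homeomorph.Set.univ (Fin 3 → ℝ)).toOpenPartialHomeomorph :=
    ⟨⟨univ, isOpen_univ, rfl, id, fun x _ => analyticAt_id, fun x _ => rfl⟩,
      fun x _ => analyticAt_id⟩
  refine ⟨chart hν k, isLocalCoordinate_chart hν k, hk, _,
    hU.trans (ambientChart_isBianalytic hν k), fun a ha => ?_⟩
  have e := chart_symm_apply hν k a
  have ha' : (a : Fin 3 → ℝ) ∈ (ambientChart hν k).target := ha
  constructor
  · rw [OpenPartialHomeomorph.trans_source]
    refine ⟨mem_univ _, ?_⟩
    change ((chart hν k).symm a : Fin 3 → ℝ) ∈ (ambientChart hν k).source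
    rw [e]
    exact (ambientChart hν k).map_target ha'
  · change ambientChart hν k ((chart hν k).symm a : Fin 3 → ℝ) = _
    rw [e, (ambientChart hν k).right_inv ha']
    ext i
    simp

end CatenoidTH


/-! ## Coordinates of de Sitter space and regularity of `fTilde` -/

theorem mem_deSitter3_iff {p : Fin 4 → ℝ} :
    p ∈ deSitter3 ↔ -(p 0 * p 0) + p 1 * p 1 + p 2 * p 2 + p 3 * p 3 = 1 := Iff.rfl

/-- The inverse of the coordinate system `x ↦ (x₁, x₂, x₃ + δ x₀)` of de Sitter space. -/
def nullCoordinateInv (δ : ℝ) (y : Fin 3 → ℝ) : Fin 4 → ℝ :=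
  ![δ * (y 2 - (1 - y 0 ^ 2 - y 1 ^ 2) / y 2) / 2, y 0, y 1,
    (y 2 + (1 - y 0 ^ 2 - y 1 ^ 2) / y 2) / 2]

/-- The equation of `S³₁` reads `(x₃ + δ x₀)(x₃ - δ x₀) = 1 - x₁² - x₂²`; the quotient in
`nullCoordinateInv` recovers the second null coordinate from the first. -/
theorem nullCoordinateInv_mem {δ : ℝ} (hδ : δ ^ 2 = 1) {y : Fin 3 → ℝ} (hy : y 2 ≠ 0) :
    nullCoordinateInv δ y ∈ deSitter3 := by
  rw [mem_deSitter3_iff]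
  simp only [nullCoordinateInv, Matrix.cons_val]
  have h : (1 - y 0 ^ 2 - y 1 ^ 2) / y 2 * y 2 = 1 - y 0 ^ 2 - y 1 ^ 2 := div_mul_cancel₀ _ hy
  set w := (1 - y 0 ^ 2 - y 1 ^ 2) / y 2
  linear_combination h - (y 2 - w) ^ 2 / 4 * hδ

theorem analyticAt_nullCoordinateInv (δ : ℝ) {y : Fin 3 → ℝ} (hy : y 2 ≠ 0) :
    AnalyticAt ℝ (nullCoordinateInv δ) y := by
  have h0 := CatenoidTH.analyticAt_proj 0 y
  have h1 := CatenoidTH.analyticAt_proj 1 y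
  have h2 := CatenoidTH.analyticAt_proj 2 y
  have hw : AnalyticAt ℝ (fun y : Fin 3 → ℝ => (1 - y 0 ^ 2 - y 1 ^ 2) / y 2) y :=
    ((analyticAt_const.sub (h0.pow 2)).sub (h1.pow 2)).div h2 hy
  refine AnalyticAt.pi fun i => ?_
  fin_cases i
  · exact (analyticAt_const.mul (h2.sub hw)).div analyticAt_const two_ne_zero
  · exact h0
  · exact h1
  · exact (h2.add hw).div analyticAt_const two_ne_zero

/-- The coordinate `x ↦ (x₁, x₂, x₃ + δ x₀)` on the vectors of `ℝ⁴`. -/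
def nullCoordinateFun (δ : ℝ) (p : Fin 4 → ℝ) : Fin 3 → ℝ := ![p 1, p 2, p 3 + δ * p 0]

theorem analyticAt_nullCoordinateFun (δ : ℝ) (p : Fin 4 → ℝ) :
    AnalyticAt ℝ (nullCoordinateFun δ) p := by
  refine AnalyticAt.pi fun i => ?_
  fin_cases i
  · exact CatenoidTH.analyticAt_proj 1 p
  · exact CatenoidTH.analyticAt_proj 2 p
  · exact (CatenoidTH.analyticAt_proj 3 p).add
      (analyticAt_const.mul (CatenoidTH.analyticAt_proj 0 p))

theorem nullCoordinateInv_nullCoordinateFun {δ : ℝ} (hδ : δ ^ 2 = 1) {p : Fin 4 → ℝ}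
    (hp : p ∈ deSitter3) (h : p 3 + δ * p 0 ≠ 0) :
    nullCoordinateInv δ (nullCoordinateFun δ p) = p := by
  rw [mem_deSitter3_iff] at hp
  have e : (1 - p 1 ^ 2 - p 2 ^ 2) / (p 3 + δ * p 0) = p 3 - δ * p 0 := by
    rw [div_eq_iff h]
    linear_combination -hp + p 0 ^ 2 * hδ
  ext i
  fin_cases i <;> simp [nullCoordinateInv, nullCoordinateFun, e]
  · linear_combination p 0 * hδ

theorem nullCoordinateFun_nullCoordinateInv {δ : ℝ} (hδ : δ ^ 2 = 1) (y : Fin 3 → ℝ) :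
    nullCoordinateFun δ (nullCoordinateInv δ y) = y := by
  ext i
  fin_cases i <;> simp [nullCoordinateInv, nullCoordinateFun]
  set w := (1 - y 0 ^ 2 - y 1 ^ 2) / y 2
  linear_combination (y 2 - w) / 2 * hδ

open Classical in
/-- The coordinate system `x ↦ (x₁, x₂, x₃ + δ x₀)` of de Sitter space, where `δ = ±1`. -/
def nullCoordinate {δ : ℝ} (hδ : δ ^ 2 = 1) :
    OpenPartialHomeomorph deSitter3 (Fin 3 → ℝ) where
  toFun p := nullCoordinateFun δ p
  -- The second branch lies outside the target and is an arbitrary default point.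
  invFun y := if hy : y 2 ≠ 0 then ⟨nullCoordinateInv δ y, nullCoordinateInv_mem hδ hy⟩
    else ⟨nullCoordinateInv δ ![0, 0, 1], nullCoordinateInv_mem hδ (by simp)⟩
  source := {p | p.1 3 + δ * p.1 0 ≠ 0}
  target := {y | y 2 ≠ 0}
  map_source' p hp := hp
  map_target' y hy := by
    have hy' : y 2 ≠ 0 := hy
    have := congrFun (nullCoordinateFun_nullCoordinateInv hδ y) 2
    simp only [nullCoordinateFun, Matrix.cons_val] at this
    simp [hy', this]
  left_inv' p hp := by
    have hp' : p.1 3 + δ * p.1 0 ≠ 0 := hp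
    have h2 : nullCoordinateFun δ p 2 ≠ 0 := hp
    apply Subtype.ext
    rw [dif_pos h2]
    exact nullCoordinateInv_nullCoordinateFun hδ p.2 hp'
  right_inv' y hy := by
    have hy' : y 2 ≠ 0 := hy
    rw [dif_pos hy']
    exact nullCoordinateFun_nullCoordinateInv hδ y
  open_source := (isOpen_ne_fun (f := fun p : Fin 4 → ℝ => p 3 + δ * p 0) (by fun_prop)
    continuous_const).preimage continuous_subtype_val
  open_target := isOpen_ne_fun (by fun_prop) continuous_const
  continuousOn_toFun := by
    refine Continuous.continuousOn ?_
    have : Continuous (nullCoordinateFun δ) :=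
      continuous_iff_continuousAt.2 fun p => (analyticAt_nullCoordinateFun δ p).continuousAt
    exact this.comp continuous_subtype_val
  continuousOn_invFun := by
    rw [Topology.IsInducing.subtypeVal.continuousOn_iff]
    intro y hy
    refine ((analyticAt_nullCoordinateInv δ hy).continuousAt.continuousWithinAt).congr ?_ ?_
    · intro z hz
      have hz' : z 2 ≠ 0 := hz
      simp [hz']
    · have hy' : y 2 ≠ 0 := hy
      simp [hy']

theorem isAnalyticCoordinate_nullCoordinate {δ : ℝ} (hδ : δ ^ 2 = 1) :
    IsAnalyticCoordinate (nullCoordinate hδ) := by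
  refine ⟨⟨{p | p 3 + δ * p 0 ≠ 0}, isOpen_ne_fun (by fun_prop) continuous_const, rfl,
    nullCoordinateFun δ, fun p _ => analyticAt_nullCoordinateFun δ p, fun p _ => rfl⟩, ?_⟩
  intro y hy
  refine (analyticAt_nullCoordinateInv δ hy).congr ?_
  filter_upwards [(nullCoordinate hδ).open_target.mem_nhds hy] with z hz
  have hz' : z 2 ≠ 0 := hz
  change _ = ((if hy : z 2 ≠ 0 then _ else _ : deSitter3) : Fin 4 → ℝ)
  rw [dif_pos hz']

namespace CatenoidTH

variable {ν : ℝ}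

/-! ### Analyticity and derivatives of the profile curve -/

theorem analyticAt_x₀ (ν s : ℝ) : AnalyticAt ℝ (x₀ ν) s := by
  have h : AnalyticAt ℝ (fun s : ℝ => s / ν) s := by
    simp only [div_eq_mul_inv]; exact analyticAt_id.mul analyticAt_const
  have hs := Real.analyticAt_sinh.fun_comp h
  have hc := Real.analyticAt_cosh.fun_comp h
  have h1 := (Real.analyticAt_sin.mul hs).sub
    (((analyticAt_const (v := (ν ^ 2 - 1))).mul Real.analyticAt_cos).mul hc |>.mul
      (analyticAt_const (v := (2 * ν)⁻¹)))
  exact h1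

theorem analyticAt_x₃ (ν s : ℝ) : AnalyticAt ℝ (x₃ ν) s := by
  have h : AnalyticAt ℝ (fun s : ℝ => s / ν) s := by
    simp only [div_eq_mul_inv]; exact analyticAt_id.mul analyticAt_const
  have hs := Real.analyticAt_sinh.fun_comp h
  have hc := Real.analyticAt_cosh.fun_comp h
  have h1 := (Real.analyticAt_sin.mul hc).sub
    (((analyticAt_const (v := (ν ^ 2 - 1))).mul Real.analyticAt_cos).mul hs |>.mul
      (analyticAt_const (v := (2 * ν)⁻¹)))
  exact h1

theorem hasDerivAt_sinh_div (ν s : ℝ) :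
    HasDerivAt (fun s => Real.sinh (s / ν)) (Real.cosh (s / ν) / ν) s := by
  simpa [div_eq_mul_inv] using ((hasDerivAt_id s).div_const ν).sinh

theorem hasDerivAt_cosh_div (ν s : ℝ) :
    HasDerivAt (fun s => Real.cosh (s / ν)) (Real.sinh (s / ν) / ν) s := by
  simpa [div_eq_mul_inv] using ((hasDerivAt_id s).div_const ν).cosh

theorem hasDerivAt_x₀ (hν : 0 < ν) (s : ℝ) :
    HasDerivAt (x₀ ν) (amp ν * (Real.cos s / ν * Real.sinh (s / ν) +
      Real.sin s * Real.cosh (s / ν))) s := by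
  have h := ((Real.hasDerivAt_sin s).mul (hasDerivAt_sinh_div ν s)).sub
    (((((Real.hasDerivAt_cos s).const_mul (ν ^ 2 - 1)).mul (hasDerivAt_cosh_div ν s)).div_const
      (2 * ν)))
  refine h.congr_deriv ?_
  unfold amp
  field_simp
  ring

theorem hasDerivAt_x₃ (hν : 0 < ν) (s : ℝ) :
    HasDerivAt (x₃ ν) (amp ν * (Real.cos s / ν * Real.cosh (s / ν) +
      Real.sin s * Real.sinh (s / ν))) s := by
  have h := ((Real.hasDerivAt_sin s).mul (hasDerivAt_cosh_div ν s)).sub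
    (((((Real.hasDerivAt_cos s).const_mul (ν ^ 2 - 1)).mul (hasDerivAt_sinh_div ν s)).div_const
      (2 * ν)))
  refine h.congr_deriv ?_
  unfold amp
  field_simp
  ring

/-- The null coordinate `x₃ + δ x₀` of the profile curve. -/
def nullComponent (ν δ s : ℝ) : ℝ := x₃ ν s + δ * x₀ ν s

theorem hasDerivAt_nullComponent (hν : 0 < ν) {δ : ℝ} (hδ : δ ^ 2 = 1) (s : ℝ) :
    HasDerivAt (nullComponent ν δ) (amp ν * (Real.cosh (s / ν) + δ * Real.sinh (s / ν)) *
      (Real.cos s / ν + δ * Real.sin s)) s := by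
  refine ((hasDerivAt_x₃ hν s).add ((hasDerivAt_x₀ hν s).const_mul δ)).congr_deriv ?_
  linear_combination -amp ν * Real.sin s * Real.sinh (s / ν) * hδ

theorem cosh_add_mul_sinh_ne_zero {δ : ℝ} (hδ : δ ^ 2 = 1) (t : ℝ) :
    Real.cosh t + δ * Real.sinh t ≠ 0 := by
  intro h
  have h1 := Real.cosh_sq t
  have : (Real.cosh t + δ * Real.sinh t) * (Real.cosh t - δ * Real.sinh t) = 1 := by
    linear_combination h1 - Real.sinh t ^ 2 * hδ
  rw [h, zero_mul] at this
  exact zero_ne_one this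

/-- If both null components vanished, so would `x₀` and `x₃`. Undoing the boost by `s / ν` would
then give `sin s = 0` and `(ν² - 1) cos s = 0`, which `ν ≠ 1` excludes. -/
theorem nullComponent_ne_zero (hν : 0 < ν) (hν1 : ν ≠ 1) (s : ℝ) :
    ∃ δ : ℝ, δ ^ 2 = 1 ∧ nullComponent ν δ s ≠ 0 := by
  by_contra! h
  have h1 := h 1 (by norm_num)
  have h2 := h (-1) (by norm_num)
  unfold nullComponent at h1 h2
  have h3 : x₃ ν s = 0 := by linarith
  have h0 : x₀ ν s = 0 := by linarith
  have hc := Real.cosh_sq (s / ν)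
  have hS : Real.sin s = x₃ ν s * Real.cosh (s / ν) - x₀ ν s * Real.sinh (s / ν) := by
    unfold x₀ x₃
    linear_combination -Real.sin s * hc
  have hD : (ν ^ 2 - 1) * Real.cos s = 2 * ν *
      (x₃ ν s * Real.sinh (s / ν) - x₀ ν s * Real.cosh (s / ν)) := by
    unfold x₀ x₃
    field_simp
    linear_combination -(ν ^ 2 - 1) * Real.cos s * hc
  rw [h3, h0] at hS hD
  have hν2 : ν ^ 2 - 1 ≠ 0 := by
    intro h
    have : (ν - 1) * (ν + 1) = 0 := by linear_combination h
    rcases mul_eq_zero.1 this with h | h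
    · exact hν1 (by linarith)
    · linarith
  have hcos : Real.cos s = 0 := by
    have : (ν ^ 2 - 1) * Real.cos s = 0 := by rw [hD]; ring
    exact (mul_eq_zero.1 this).resolve_left hν2
  have := Real.sin_sq_add_cos_sq s
  rw [hS, hcos] at this
  norm_num at this

/-- The expression is the `s`-derivative of the last component of `straightening`. Where the
derivative of `nullComponent` vanishes, `cos s / ν = -δ sin s` forces `sin s` and `cos s` to be
nonzero, and `b = 1` works; elsewhere `b = 0` does. -/
theorem exists_deriv_ne_zero (hν : 0 < ν) {δ : ℝ} (hδ : δ ^ 2 = 1) (s : ℝ) :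
    ∃ b : ℝ, amp ν * (Real.cosh (s / ν) + δ * Real.sinh (s / ν)) *
      (Real.cos s / ν + δ * Real.sin s) + b * (2 * amp ν ^ 2 * Real.cos s * Real.sin s) ≠ 0 := by
  by_cases h : Real.cos s / ν + δ * Real.sin s = 0
  · have hδ0 : δ ≠ 0 := by rintro rfl; norm_num at hδ
    have hsc := Real.sin_sq_add_cos_sq s
    refine ⟨1, ?_⟩
    rw [h, mul_zero, zero_add, one_mul]
    have hc : Real.cos s ≠ 0 := by
      intro hc
      rw [hc] at h hsc
      have : Real.sin s = 0 := by simpa [hδ0] using h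
      rw [this] at hsc; norm_num at hsc
    have hs : Real.sin s ≠ 0 := by
      intro hs
      rw [hs] at h
      have : Real.cos s = 0 := by simpa [hν.ne'] using h
      exact hc this
    have := (amp_pos hν).ne'
    positivity
  · refine ⟨0, ?_⟩
    rw [zero_mul, add_zero]
    exact mul_ne_zero (mul_ne_zero (amp_pos hν).ne' (cosh_add_mul_sinh_ne_zero hδ _)) h

/-- A map of `ℝ³` that agrees on `X` with `fTilde` in null coordinates. -/
def straightening (ν δ b : ℝ) (p : Fin 3 → ℝ) : Fin 3 → ℝ :=
  -- The `b`-term is a multiple of the defining function of `X`: zero on `X`, but able to repair a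
  -- vanishing derivative in the direction of `s`.
  ![p 0, p 1, nullComponent ν δ (p 2) +
    b * (p 0 ^ 2 + p 1 ^ 2 - (amp ν * Real.cos (p 2)) ^ 2)]

theorem analyticAt_nullComponent (ν δ s : ℝ) : AnalyticAt ℝ (nullComponent ν δ) s :=
  (analyticAt_x₃ ν s).add (analyticAt_const.mul (analyticAt_x₀ ν s))

theorem analyticAt_straightening (ν δ b : ℝ) (p : Fin 3 → ℝ) :
    AnalyticAt ℝ (straightening ν δ b) p := by
  have h0 := analyticAt_proj 0 p
  have h1 := analyticAt_proj 1 p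
  have h2 := analyticAt_proj 2 p
  refine AnalyticAt.pi fun i => ?_
  fin_cases i
  · exact h0
  · exact h1
  · exact ((analyticAt_nullComponent ν δ _).fun_comp h2).add (analyticAt_const.mul
      (((h0.pow 2).add (h1.pow 2)).sub
        ((analyticAt_const.mul (Real.analyticAt_cos.fun_comp h2)).pow 2)))

theorem injective_fderiv_straightening (hν : 0 < ν) {δ : ℝ} (hδ : δ ^ 2 = 1) {b : ℝ}
    {p : Fin 3 → ℝ} (hb : amp ν * (Real.cosh (p 2 / ν) + δ * Real.sinh (p 2 / ν)) *
      (Real.cos (p 2) / ν + δ * Real.sin (p 2)) +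
        b * (2 * amp ν ^ 2 * Real.cos (p 2) * Real.sin (p 2)) ≠ 0) :
    Function.Injective (fderiv ℝ (straightening ν δ b) p) := by
  rw [injective_iff_map_eq_zero]
  intro v hv
  have hl : ∀ i, HasDerivAt (fun t : ℝ => p i + t * v i) (v i) 0 := fun i => by
    simpa using ((hasDerivAt_id (0 : ℝ)).mul_const (v i)).const_add (p i)
  have h1 : HasDerivAt (fun t : ℝ => p + t • v) v 0 := hasDerivAt_pi.2 hl
  have h2 : HasFDerivAt (straightening ν δ b) (fderiv ℝ (straightening ν δ b) p)
      (p + (0 : ℝ) • v) := by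
    simpa using (analyticAt_straightening ν δ b p).differentiableAt.hasFDerivAt
  have h3 := h2.comp_hasDerivAt (0 : ℝ) h1
  rw [hv] at h3
  have hc := hasDerivAt_pi.1 h3
  have v0 : v 0 = 0 := (hl 0).unique (hc 0)
  have v1 : v 1 = 0 := (hl 1).unique (hc 1)
  have hp2 : p 2 + 0 * v 2 = p 2 := by ring
  have d2 := ((hasDerivAt_nullComponent hν hδ (p 2 + 0 * v 2)).comp (0 : ℝ) (hl 2)).add
    (((((hl 0).pow 2).add ((hl 1).pow 2)).sub
      ((((Real.hasDerivAt_cos _).comp (0 : ℝ) (hl 2)).const_mul (amp ν)).pow 2)).const_mul b)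
  have e := d2.unique (hc 2)
  simp only [hp2, v0, v1, Pi.zero_apply] at e
  have v2 : v 2 = 0 := by
    refine (mul_eq_zero.1 (a := _) ?_).resolve_left hb
    rw [← e]
    simp
    ring
  ext i; fin_cases i
  exacts [v0, v1, v2]

/-- On `X`, `fTilde` in null coordinates equals the local diffeomorphism `B` of `ℝ³`. Composing the
null coordinates with `B.symm` thus reduces `fTilde` to the inclusion, and the ambient chart
finishes as for `incl`. -/
theorem isDCRegularAt_fTilde (hν : 0 < ν) (hν1 : ν ≠ 1) (p : X ν) :
    (dcStructure hν).IsDCRegularAt 3 (fTilde hν) p := by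
  obtain ⟨k, hk⟩ := exists_abs_sub_node_lt (p.1 2)
  obtain ⟨δ, hδ, hδp⟩ := nullComponent_ne_zero hν hν1 (p.1 2)
  obtain ⟨b, hb⟩ := exists_deriv_ne_zero hν hδ (p.1 2)
  have hcont : Continuous (nullComponent ν δ) :=
    continuous_iff_continuousAt.2 fun s => (analyticAt_nullComponent ν δ s).continuousAt
  have hW : IsOpen {q : Fin 3 → ℝ | nullComponent ν δ (q 2) ≠ 0} :=
    isOpen_ne_fun (by fun_prop) continuous_const
  obtain ⟨B, hB, hpB, hBW, hBeq⟩ := OpenPartialHomeomorph.exists_isBianalytic rfl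
    (analyticAt_straightening ν δ b p.1)
    (analyticAt_straightening ν δ b p.1).differentiableAt.hasFDerivAt
    (injective_fderiv_straightening hν hδ hb) (hW.mem_nhds hδp)
  let A := (ambientChart hν k).restrOpen B.source B.open_source
  have hA : A.IsBianalytic := (ambientChart_isBianalytic hν k).restr B.open_source
  have hAX : ∀ q ∈ A.source, q ∈ X ν ↔ A q ∈ doubleCone 2 := fun q hq =>
    ambientChart_mem_iff hν k q hq.1
  refine ⟨_, isLocalCoordinate_induced hν hA hAX, ⟨hk, hpB⟩,
    ((nullCoordinate hδ).trans B.symm).trans (ambientChart hν k),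
    ((isAnalyticCoordinate_nullCoordinate hδ).trans hB.symm).trans (ambientChart_isBianalytic hν k),
    fun a ha => ?_⟩
  have ha' : (a : Fin 3 → ℝ) ∈ A.target := ha
  have hq : ((A.induced hAX (basePoint ν) coneVertex).symm a : Fin 3 → ℝ) = A.symm a :=
    A.induced_symm_apply_of_mem _ _ _ ha'
  have hAa : A (A.symm a) = a := A.right_inv ha'
  have hqs : A.symm a ∈ A.source := A.map_target ha'
  set q := (A.induced hAX (basePoint ν) coneVertex).symm a with hqdef
  rw [← hq] at hqs hAa
  have hqX := mem_X.1 q.2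
  have e1 : nullCoordinate hδ (fTilde hν q) = B q := by
    rw [hBeq]
    change nullCoordinateFun δ ![x₀ ν (q.1 2), q.1 0, q.1 1, x₃ ν (q.1 2)] = _
    ext i
    fin_cases i <;> simp [nullCoordinateFun, straightening, nullComponent, hqX]
  have e2 : B.symm (B q) = q := B.left_inv hqs.2
  constructor
  · simp only [OpenPartialHomeomorph.trans_source, mem_inter_iff, mem_preimage,
      OpenPartialHomeomorph.coe_trans, Function.comp_apply, OpenPartialHomeomorph.symm_source]
    refine ⟨⟨hBW hqs.2, ?_⟩, ?_⟩
    · rw [e1]; exact B.map_source hqs.2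
    · rw [e1, e2]; exact hqs.1
  · simp only [OpenPartialHomeomorph.coe_trans, Function.comp_apply]
    rw [e1, e2]
    change A q = _
    rw [hAa]
    ext i
    simp

theorem isDCImmersion_fTilde (hν : 0 < ν) (hν1 : ν ≠ 1) :
    (dcStructure hν).IsDCImmersion 3 (fTilde hν) := by
  refine ⟨by norm_num, isDCAnalytic_of_extends hν
    (G := fun p => ![x₀ ν (p 2), p 0, p 1, x₃ ν (p 2)]) (fun p => ?_) fun p => rfl,
    isDCRegularAt_fTilde hν hν1⟩
  refine AnalyticAt.pi fun i => ?_
  fin_cases i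
  · exact (analyticAt_x₀ ν _).fun_comp (analyticAt_proj 2 p)
  · exact analyticAt_proj 0 p
  · exact analyticAt_proj 1 p
  · exact (analyticAt_x₃ ν _).fun_comp (analyticAt_proj 2 p)

end CatenoidTH


/-! ## The mean curvature -/

/-- The vector with coordinates `(a, b, r, w)` in the Lorentz frame that is obtained by the boost
`τ` in the `x₀x₃`-plane and the rotation `θ` in the `x₁x₂`-plane. -/
def lorentzFrame (τ θ a b r w : ℝ) : Fin 4 → ℝ :=
  ![a * Real.sinh τ + b * Real.cosh τ, r * Real.cos θ - w * Real.sin θ,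
    r * Real.sin θ + w * Real.cos θ, a * Real.cosh τ + b * Real.sinh τ]

/-- The four frame vectors are orthonormal and only the one belonging to `b` is time-like. All
fundamental forms below reduce to this diagonal form. -/
theorem lorentz_lorentzFrame (τ θ a b r w a' b' r' w' : ℝ) :
    lorentz (lorentzFrame τ θ a b r w) (lorentzFrame τ θ a' b' r' w') =
      a * a' - b * b' + r * r' + w * w' := by
  have h1 := Real.cosh_sq τ
  have h2 := Real.sin_sq_add_cos_sq θ
  simp only [lorentz, lorentzFrame, Matrix.cons_val]
  linear_combination (a * a' - b * b') * h1 + (r * r' + w * w') * h2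

namespace CatenoidTH

variable {ν : ℝ}

/-- The parametrization of `fTilde` by polar coordinates of the cone in the chart at `node k`. -/
def polarParam (ν : ℝ) (k : ℤ) (u v : ℝ) : Fin 4 → ℝ :=
  ![x₀ ν (node k + u), amp ν * Real.sin u * Real.cos v, amp ν * Real.sin u * Real.sin v,
    x₃ ν (node k + u)]

theorem chart_symm_conePolar (hν : 0 < ν) (k : ℤ) (u v : ℝ) :
    ((chart hν k).symm (conePolar u v) : Fin 3 → ℝ) =
      ![amp ν * Real.sin u * Real.cos v, amp ν * Real.sin u * Real.sin v, node k + u] := by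
  rw [chart_symm_apply, ambientChart_symm_apply]
  have h := Real.mul_sinc u
  ext i
  fin_cases i <;> simp [conePolar, ← h] <;> ring

theorem fTilde_chart_symm_conePolar (hν : 0 < ν) (k : ℤ) :
    (fun u v => (fTilde hν ((chart hν k).symm (conePolar u v)) : Fin 4 → ℝ)) =
      polarParam ν k := by
  ext u v i
  simp only [fTilde, chart_symm_conePolar]
  rfl

theorem polarParam_eq (ν : ℝ) (k : ℤ) (u v : ℝ) :
    polarParam ν k u v = lorentzFrame ((node k + u) / ν) v (Real.sin (node k + u))
      (-((ν ^ 2 - 1) / (2 * ν) * Real.cos (node k + u))) (amp ν * Real.sin u) 0 := by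
  ext i
  fin_cases i <;> simp [polarParam, lorentzFrame, x₀, x₃] <;> ring

theorem hasDerivAt_node_add (k : ℤ) (u : ℝ) : HasDerivAt (fun u => node k + u) 1 u :=
  (hasDerivAt_id u).const_add _

theorem hasDerivAt_comp_node_add {g : ℝ → ℝ} {g' : ℝ} (k : ℤ) {u : ℝ}
    (h : HasDerivAt g g' (node k + u)) : HasDerivAt (fun u => g (node k + u)) g' u := by
  exact (h.comp u (hasDerivAt_node_add k u)).congr_deriv (mul_one _)

theorem partialU_polarParam (hν : 0 < ν) (k : ℤ) :
    partialU (polarParam ν k) = fun u v => lorentzFrame ((node k + u) / ν) v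
      (amp ν * Real.cos (node k + u) / ν) (amp ν * Real.sin (node k + u))
      (amp ν * Real.cos u) 0 := by
  ext1 u; ext1 v
  refine HasDerivAt.deriv (hasDerivAt_pi.2 fun i => ?_)
  fin_cases i
  · refine (hasDerivAt_comp_node_add k (hasDerivAt_x₀ hν (node k + u))).congr_deriv ?_
    simp [lorentzFrame]; ring
  · refine (((Real.hasDerivAt_sin u).const_mul (amp ν)).mul_const (Real.cos v)).congr_deriv ?_
    simp [lorentzFrame]
  · refine (((Real.hasDerivAt_sin u).const_mul (amp ν)).mul_const (Real.sin v)).congr_deriv ?_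
    simp [lorentzFrame]
  · refine (hasDerivAt_comp_node_add k (hasDerivAt_x₃ hν (node k + u))).congr_deriv ?_
    simp [lorentzFrame]; ring

theorem partialV_polarParam (ν : ℝ) (k : ℤ) :
    partialV (polarParam ν k) = fun u v => lorentzFrame ((node k + u) / ν) v 0 0 0
      (amp ν * Real.sin u) := by
  ext1 u; ext1 v
  refine HasDerivAt.deriv (hasDerivAt_pi.2 fun i => ?_)
  fin_cases i
  · refine (hasDerivAt_const v (x₀ ν (node k + u))).congr_deriv ?_
    simp [lorentzFrame]
  · refine ((Real.hasDerivAt_cos v).const_mul (amp ν * Real.sin u)).congr_deriv ?_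
    simp [lorentzFrame]
  · refine ((Real.hasDerivAt_sin v).const_mul (amp ν * Real.sin u)).congr_deriv ?_
    simp [lorentzFrame]
  · refine (hasDerivAt_const v (x₃ ν (node k + u))).congr_deriv ?_
    simp [lorentzFrame]

theorem partialV_partialV_polarParam (ν : ℝ) (k : ℤ) :
    partialV (partialV (polarParam ν k)) = fun u v => lorentzFrame ((node k + u) / ν) v 0 0
      (-(amp ν * Real.sin u)) 0 := by
  rw [partialV_polarParam]
  ext1 u; ext1 v
  refine HasDerivAt.deriv (hasDerivAt_pi.2 fun i => ?_)
  fin_cases i <;> simp [lorentzFrame]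
  · exact hasDerivAt_const _ _
  · exact ((Real.hasDerivAt_sin v).const_mul (amp ν * Real.sin u)).neg
  · exact ((Real.hasDerivAt_cos v).const_mul (amp ν * Real.sin u)).congr_deriv (by ring)
  · exact hasDerivAt_const _ _

theorem partialV_partialU_polarParam (hν : 0 < ν) (k : ℤ) :
    partialV (partialU (polarParam ν k)) = fun u v => lorentzFrame ((node k + u) / ν) v 0 0
      0 (amp ν * Real.cos u) := by
  rw [partialU_polarParam hν]
  ext1 u; ext1 v
  refine HasDerivAt.deriv (hasDerivAt_pi.2 fun i => ?_)
  fin_cases i <;> simp [lorentzFrame]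
  · exact hasDerivAt_const _ _
  · exact ((Real.hasDerivAt_cos v).const_mul (amp ν * Real.cos u)).congr_deriv (by ring)
  · exact ((Real.hasDerivAt_sin v).const_mul (amp ν * Real.cos u))
  · exact hasDerivAt_const _ _

theorem partialU_partialU_polarParam (hν : 0 < ν) (k : ℤ) :
    partialU (partialU (polarParam ν k)) = fun u v => lorentzFrame ((node k + u) / ν) v 0
      (amp ν * (1 + 1 / ν ^ 2) * Real.cos (node k + u)) (-(amp ν * Real.sin u)) 0 := by
  rw [partialU_polarParam hν]
  ext1 u; ext1 v
  refine HasDerivAt.deriv (hasDerivAt_pi.2 fun i => ?_)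
  have hc := ((Real.hasDerivAt_cos (node k + u)).const_mul (amp ν)).div_const ν
  have hs := (Real.hasDerivAt_sin (node k + u)).const_mul (amp ν)
  have hch := hasDerivAt_cosh_div ν (node k + u)
  have hsh := hasDerivAt_sinh_div ν (node k + u)
  fin_cases i <;> simp [lorentzFrame]
  · refine (hasDerivAt_comp_node_add k ((hc.mul hsh).add (hs.mul hch))).congr_deriv ?_
    field_simp
    ring
  · exact (((Real.hasDerivAt_cos u).const_mul (amp ν)).mul_const (Real.cos v)).congr_deriv (by ring)
  · exact (((Real.hasDerivAt_cos u).const_mul (amp ν)).mul_const (Real.sin v)).congr_deriv (by ring)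
  · refine (hasDerivAt_comp_node_add k ((hc.mul hch).add (hs.mul hsh))).congr_deriv ?_
    field_simp
    ring

/-- The coefficient of the unit normal field along the boosted time direction. -/
def normalTime (ν s : ℝ) : ℝ :=
  -(ν ^ 2 * Real.sin s ^ 2 + (ν ^ 2 + 1) / 2 * Real.cos s ^ 2) / (ν * Real.cos s)

/-- The coefficient of the unit normal field along the radial direction. -/
def normalRadial (ν s : ℝ) : ℝ :=
  (ν ^ 2 * Real.sin s ^ 2 + (ν ^ 2 - 1) / 2 * Real.cos s ^ 2) / (ν * Real.cos s)

/-- The unit normal field of `fTilde`. -/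
def normal (ν : ℝ) (p : X ν) : Fin 4 → ℝ :=
  ![-Real.sin (p.1 2) * Real.sinh (p.1 2 / ν) + normalTime ν (p.1 2) * Real.cosh (p.1 2 / ν),
    -- The quotients are the cosine and sine of the rotation angle, written in `ξ, η, s` so that the
    -- field does not depend on a chart.
    normalRadial ν (p.1 2) * (p.1 0 / (amp ν * Real.cos (p.1 2))),
    normalRadial ν (p.1 2) * (p.1 1 / (amp ν * Real.cos (p.1 2))),
    -Real.sin (p.1 2) * Real.cosh (p.1 2 / ν) + normalTime ν (p.1 2) * Real.sinh (p.1 2 / ν)]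

theorem continuousOn_normal (hν : 0 < ν) :
    ContinuousOn (normal ν) (dcStructure hν).dcPointsᶜ := by
  have hne : ∀ p ∈ (dcStructure hν).dcPointsᶜ, Real.cos (p.1 2) ≠ 0 := fun p hp h =>
    hp ((mem_dcPoints hν).2 h)
  have c : ∀ i : Fin 3, ContinuousOn (fun p : X ν => p.1 i) (dcStructure hν).dcPointsᶜ := fun i =>
    ((continuous_apply i).comp continuous_subtype_val).continuousOn
  have ca := c 0
  have cb := c 1
  have cs := c 2
  have csin := Real.continuous_sin.comp_continuousOn cs
  have ccos := Real.continuous_cos.comp_continuousOn cs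
  have csinh := Real.continuous_sinh.comp_continuousOn (cs.div_const ν)
  have ccosh := Real.continuous_cosh.comp_continuousOn (cs.div_const ν)
  have d1 : ∀ p ∈ (dcStructure hν).dcPointsᶜ, ν * Real.cos (p.1 2) ≠ 0 := fun p hp =>
    mul_ne_zero hν.ne' (hne p hp)
  have d2 : ∀ p ∈ (dcStructure hν).dcPointsᶜ, amp ν * Real.cos (p.1 2) ≠ 0 := fun p hp =>
    mul_ne_zero (amp_pos hν).ne' (hne p hp)
  have ct : ContinuousOn (fun p : X ν => normalTime ν (p.1 2)) (dcStructure hν).dcPointsᶜ :=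
    ContinuousOn.div (((continuousOn_const.mul (csin.pow 2)).add
      (continuousOn_const.mul (ccos.pow 2))).neg) (continuousOn_const.mul ccos) d1
  have cr : ContinuousOn (fun p : X ν => normalRadial ν (p.1 2)) (dcStructure hν).dcPointsᶜ :=
    ContinuousOn.div ((continuousOn_const.mul (csin.pow 2)).add
      (continuousOn_const.mul (ccos.pow 2))) (continuousOn_const.mul ccos) d1
  refine continuousOn_pi.2 fun i => ?_
  fin_cases i
  · exact (csin.neg.mul csinh).add (ct.mul ccosh)
  · exact cr.mul (ca.div (continuousOn_const.mul ccos) d2)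
  · exact cr.mul (cb.div (continuousOn_const.mul ccos) d2)
  · exact (csin.neg.mul ccosh).add (ct.mul csinh)

/-- The signed radius in the chart is `amp ν * sin u = -(-1)^k * amp ν * cos (node k + u)`, so the
polar angle `v` agrees with the rotation angle up to a half turn; hence the sign in the radial
coefficient. -/
theorem normal_chart_symm_conePolar (hν : 0 < ν) (k : ℤ) {u : ℝ} (hu : Real.sin u ≠ 0) (v : ℝ) :
    normal ν ((chart hν k).symm (conePolar u v)) = lorentzFrame ((node k + u) / ν) v
      (-Real.sin (node k + u)) (normalTime ν (node k + u))
      (-((-1 : ℝ) ^ k * normalRadial ν (node k + u))) 0 := by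
  have hsq := neg_one_zpow_sq k
  have he : ((-1 : ℝ) ^ k) ≠ 0 := by intro h; rw [h] at hsq; norm_num at hsq
  have ha := (amp_pos hν).ne'
  have key : ∀ y : ℝ, amp ν * Real.sin u * y / (amp ν * Real.cos (node k + u)) =
      -((-1 : ℝ) ^ k * y) := by
    intro y
    rw [cos_node_add, div_eq_iff (by simp [hu, he, ha])]
    linear_combination (-(amp ν) * Real.sin u * y) * hsq
  ext i
  fin_cases i <;> simp only [normal, chart_symm_conePolar, lorentzFrame] <;> simp [key] <;> ring

/-- Off the DC-points, `fTilde` is a space-like immersion of mean curvature one. -/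
theorem isSpacelikeCMC1_polarParam (hν : 0 < ν) (k : ℤ) {u : ℝ} (hu : Real.sin u ≠ 0) (v : ℝ) :
    IsSpacelikeAt (polarParam ν k) u v ∧
    IsUnitNormalAt (polarParam ν k) (normal ν ((chart hν k).symm (conePolar u v))) u v ∧
    meanCurvature (polarParam ν k) (normal ν ((chart hν k).symm (conePolar u v))) u v = 1 := by
  rw [normal_chart_symm_conePolar hν k hu]
  have hsq := neg_one_zpow_sq k
  have hsc := Real.sin_sq_add_cos_sq u
  have ha := amp_pos hν
  -- Since `cos² (node k + u) = sin² u` and `sin² (node k + u) = cos² u`, the time-like and radial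
  -- parts cancel.
  have hE : coeffE (polarParam ν k) u v = (amp ν * Real.sin u / ν) ^ 2 := by
    simp only [coeffE, partialU_polarParam hν, lorentz_lorentzFrame]
    rw [cos_node_add, sin_node_add]
    field_simp
    linear_combination amp ν ^ 2 * (Real.sin u ^ 2 - ν ^ 2 * Real.cos u ^ 2) * hsq
  have hF : coeffF (polarParam ν k) u v = 0 := by
    simp only [coeffF, partialU_polarParam hν, partialV_polarParam, lorentz_lorentzFrame]
    ring
  have hG : coeffG (polarParam ν k) u v = (amp ν * Real.sin u) ^ 2 := by
    simp only [coeffG, partialV_polarParam, lorentz_lorentzFrame]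
    ring
  refine ⟨⟨?_, ?_⟩, ⟨?_, ?_, ?_, ?_⟩, ?_⟩
  · rw [hE]; positivity
  · rw [hE, hF, hG, zero_pow two_ne_zero, sub_zero]; positivity
  · rw [lorentz_lorentzFrame]
    simp only [normalTime, normalRadial, cos_node_add, sin_node_add]
    -- Once `(-1)^k` is replaced by `±1`, a polynomial identity modulo `sin² + cos² = 1` remains.
    rcases sq_eq_one_iff.1 hsq with h | h <;> rw [h] <;> field_simp <;> grind
  · rw [polarParam_eq, lorentz_lorentzFrame]
    simp only [normalTime, normalRadial, cos_node_add, sin_node_add, amp]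
    rcases sq_eq_one_iff.1 hsq with h | h <;> rw [h] <;> field_simp <;> grind
  · rw [partialU_polarParam hν, lorentz_lorentzFrame]
    simp only [normalTime, normalRadial, cos_node_add, sin_node_add, amp]
    rcases sq_eq_one_iff.1 hsq with h | h <;> rw [h] <;> field_simp <;> grind
  · rw [partialV_polarParam, lorentz_lorentzFrame]
    ring
  · simp only [meanCurvature, hE, hF, hG, partialU_partialU_polarParam hν,
      partialV_partialU_polarParam hν, partialV_partialV_polarParam, lorentz_lorentzFrame]
    simp only [normalTime, normalRadial, cos_node_add, sin_node_add]
    rw [zero_pow two_ne_zero, sub_zero, div_eq_one_iff_eq (by positivity)]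
    unfold amp
    rcases sq_eq_one_iff.1 hsq with h | h <;> rw [h] <;> field_simp <;> grind

theorem isSpacelikeCMC1DCImmersion_fTilde (hν : 0 < ν) (hν1 : ν ≠ 1) :
    (dcStructure hν).IsSpacelikeCMC1DCImmersion (fTilde hν) := by
  refine ⟨connectedSpace_X ν, isDCImmersion_fTilde hν hν1, normal ν, continuousOn_normal hν, ?_⟩
  rintro _ ⟨k, rfl⟩ t θ ht hmem
  have ht' : |t| < Real.pi := hmem
  rw [abs_lt] at ht'
  have hs : Real.sin t ≠ 0 := fun h =>
    ht ((Real.sin_eq_zero_iff_of_lt_of_lt ht'.1 ht'.2).1 h)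
  intro P
  have hP : P = polarParam ν k := fTilde_chart_symm_conePolar hν k
  rw [hP]
  exact isSpacelikeCMC1_polarParam hν k hs θ

end CatenoidTH


/-! ## Analytic continuation along immersed plane curves -/

/-- An immersed analytic plane curve is a coordinate line of a bianalytic coordinate system. -/
theorem exists_isBianalytic_of_curve {k : ℝ → ℝ × ℝ} {s : ℝ} (hk : AnalyticAt ℝ k s)
    (hk' : deriv k s ≠ 0) {J : Set ℝ} (hJ : J ∈ 𝓝 s) :
    ∃ B : OpenPartialHomeomorph (ℝ × ℝ) (ℝ × ℝ), B.IsBianalytic ∧ (s, (0 : ℝ)) ∈ B.source ∧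
      (∀ q ∈ B.source, q.1 ∈ J) ∧ ∀ r, B (r, 0) = k r := by
  set w := deriv k s with hw
  -- The coordinate map is `(r, y) ↦ k r + y • Jw`, where `Jw` is the tangent vector `w` turned by a
  -- right angle; `w` and `Jw` are independent.
  have hd : HasFDerivAt (fun q : ℝ × ℝ => k q.1 + q.2 • ((-w.2, w.1) : ℝ × ℝ))
      (((ContinuousLinearMap.toSpanSingleton ℝ w).comp (ContinuousLinearMap.fst ℝ ℝ ℝ)) +
        (ContinuousLinearMap.snd ℝ ℝ ℝ).smulRight ((-w.2, w.1) : ℝ × ℝ)) (s, 0) := by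
    have h1 : HasFDerivAt k (ContinuousLinearMap.toSpanSingleton ℝ w) s :=
      hk.differentiableAt.hasDerivAt.hasFDerivAt
    have h2 : HasFDerivAt (fun q : ℝ × ℝ => q.1) (ContinuousLinearMap.fst ℝ ℝ ℝ) (s, (0 : ℝ)) :=
      hasFDerivAt_fst
    have h3 : HasFDerivAt (fun q : ℝ × ℝ => q.2) (ContinuousLinearMap.snd ℝ ℝ ℝ) (s, (0 : ℝ)) :=
      hasFDerivAt_snd
    exact (HasFDerivAt.comp (s, (0 : ℝ)) h1 h2).add (h3.smul_const _)
  have ha : AnalyticAt ℝ (fun q : ℝ × ℝ => k q.1 + q.2 • ((-w.2, w.1) : ℝ × ℝ)) (s, 0) :=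
    (AnalyticAt.fun_comp (g := k) (f := Prod.fst) (x := (s, (0 : ℝ))) hk analyticAt_fst).add
      (analyticAt_snd.smul analyticAt_const)
  have hinj : Function.Injective
      (((ContinuousLinearMap.toSpanSingleton ℝ w).comp (ContinuousLinearMap.fst ℝ ℝ ℝ)) +
        (ContinuousLinearMap.snd ℝ ℝ ℝ).smulRight ((-w.2, w.1) : ℝ × ℝ)) := by
    rw [injective_iff_map_eq_zero]
    rintro ⟨x, y⟩ h
    have h1 := congrArg Prod.fst h
    have h2 := congrArg Prod.snd h
    simp at h1 h2
    have hpos : 0 < w.1 ^ 2 + w.2 ^ 2 := by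
      by_contra hn
      refine hk' (Prod.ext ?_ ?_)
      · simp only [Prod.fst_zero]; nlinarith [sq_nonneg w.1, sq_nonneg w.2]
      · simp only [Prod.snd_zero]; nlinarith [sq_nonneg w.1, sq_nonneg w.2]
    have hx : x * (w.1 ^ 2 + w.2 ^ 2) = 0 := by linear_combination w.1 * h1 + w.2 * h2
    have hy : y * (w.1 ^ 2 + w.2 ^ 2) = 0 := by linear_combination w.1 * h2 - w.2 * h1
    exact Prod.ext ((mul_eq_zero.1 hx).resolve_right hpos.ne')
      ((mul_eq_zero.1 hy).resolve_right hpos.ne')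
  obtain ⟨B, hB, hs, hsub, hBeq⟩ := OpenPartialHomeomorph.exists_isBianalytic rfl ha hd hinj
    (W := Prod.fst ⁻¹' J) (continuous_fst.continuousAt.preimage_mem_nhds hJ)
  exact ⟨B, hB, hs, fun q hq => hsub hq, fun r => by simp [hBeq]⟩

/-- An analytic curve that meets a compact arc of an immersed analytic curve frequently near an
interior point of the arc stays in the arc. -/
theorem eventually_mem_image_arc {k : ℝ → ℝ × ℝ} (hk : ∀ s, AnalyticAt ℝ k s)
    (hk' : ∀ s, deriv k s ≠ 0) {Γ : ℝ → ℝ × ℝ} {b : ℝ} (hΓ : AnalyticAt ℝ Γ b)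
    {α β : ℝ} (hα : k α ≠ Γ b) (hβ : k β ≠ Γ b)
    (hfreq : ∃ᶠ t in 𝓝[≠] b, Γ t ∈ k '' Icc α β) : ∀ᶠ t in 𝓝 b, Γ t ∈ k '' Icc α β := by
  by_contra hgoal
  refine hfreq ?_
  -- If the conclusion fails, every parameter `s` of the arc has a neighbourhood whose image `Γ`
  -- avoids near `b`; by compactness `Γ` then avoids the whole arc near `b`.
  refine isCompact_Icc.induction_on (p := fun S => ∀ᶠ t in 𝓝[≠] b, Γ t ∉ k '' S) ?_ ?_ ?_ ?_
  · simp
  · intro S T hST hT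
    exact hT.mono fun t ht h => ht (image_mono hST h)
  · intro S T hS hT
    filter_upwards [hS, hT] with t h1 h2
    rw [image_union]
    exact fun h => h.elim h1 h2
  · intro s hs
    by_cases hsb : k s = Γ b
    · have hsI : Ioo α β ∈ 𝓝 s := by
        refine Ioo_mem_nhds (lt_of_le_of_ne hs.1 ?_) (lt_of_le_of_ne hs.2 ?_)
        · rintro rfl; exact hα hsb
        · rintro rfl; exact hβ hsb
      obtain ⟨B, hB, hsB, hBJ, hBeq⟩ := exists_isBianalytic_of_curve (hk s) (hk' s) hsI
      refine ⟨{r | (r, (0 : ℝ)) ∈ B.source}, mem_nhdsWithin_of_mem_nhds ?_, ?_⟩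
      · exact (Continuous.prodMk_left (0 : ℝ)).continuousAt.preimage_mem_nhds
          (B.open_source.mem_nhds hsB)
      · by_contra hN
        have hbt : Γ b ∈ B.target := by
          rw [← hsb, ← hBeq]; exact B.map_source hsB
        have hF : AnalyticAt ℝ (fun t => (B.symm (Γ t)).2) b :=
          analyticAt_snd.comp ((hB.2 _ hbt).comp hΓ)
        have hF0 : ∃ᶠ t in 𝓝[≠] b, (B.symm (Γ t)).2 = 0 := by
          refine Frequently.mono (p := fun t => Γ t ∈ k '' {r | (r, (0 : ℝ)) ∈ B.source}) ?_ ?_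
          · exact hN
          · rintro t ⟨r, hr, hrt⟩
            rw [← hrt, ← hBeq, B.left_inv hr]
        -- By the identity theorem the transverse coordinate of `Γ` vanishes near `b`, which puts
        -- `Γ` inside the arc and contradicts `hgoal`.
        have hev := hF.frequently_zero_iff_eventually_zero.1 hF0
        apply hgoal
        filter_upwards [hev, hΓ.continuousAt.eventually_mem (B.open_target.mem_nhds hbt)]
          with t ht htB
        have e : B.symm (Γ t) = ((B.symm (Γ t)).1, 0) := Prod.ext rfl ht
        have hsrc := B.map_target htB
        refine ⟨(B.symm (Γ t)).1, Ioo_subset_Icc_self (hBJ _ hsrc), ?_⟩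
        rw [← hBeq, ← e, B.right_inv htB]
    · obtain ⟨U, V, hU, hV, hsU, hbV, hd⟩ := t2_separation hsb
      refine ⟨k ⁻¹' U, mem_nhdsWithin_of_mem_nhds
        ((hk s).continuousAt.preimage_mem_nhds (hU.mem_nhds hsU)), ?_⟩
      refine Eventually.filter_mono nhdsWithin_le_nhds ?_
      filter_upwards [hΓ.continuousAt.eventually_mem (hV.mem_nhds hbV)] with t ht
      rintro ⟨r, hr, hrt⟩
      exact disjoint_left.1 hd hr (hrt ▸ ht)

/-- The image of an immersed analytic plane curve that is unbounded along both ends in the sense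
that every bounded set is left frequently is analytically complete. -/
theorem mem_range_of_analytic {k : ℝ → ℝ × ℝ} (hk : ∀ s, AnalyticAt ℝ k s)
    (hk' : ∀ s, deriv k s ≠ 0)
    (htop : ∀ C, ∃ᶠ s in atTop, C < ‖k s‖) (hbot : ∀ C, ∃ᶠ s in atBot, C < ‖k s‖)
    {Γ : ℝ → ℝ × ℝ} (hΓ : AnalyticOnNhd ℝ Γ (Icc 0 1)) {ε : ℝ} (hε : ε ∈ Ioo (0 : ℝ) 1)
    (h : ∀ t ∈ Ico 0 ε, Γ t ∈ range k) : ∀ t ∈ Icc (0 : ℝ) 1, Γ t ∈ range k := by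
  obtain ⟨C, hC⟩ := isCompact_Icc.exists_bound_of_continuousOn hΓ.continuousOn
  let Z : ℕ → Set ℝ := fun n => {t ∈ Icc 0 (ε / 2) | Γ t ∈ k '' Icc (-(n : ℝ)) n}
  have hcover : Icc 0 (ε / 2) ⊆ ⋃ n, Z n := by
    intro t ht
    obtain ⟨s, hs⟩ := h t ⟨ht.1, by linarith [ht.2, hε.1]⟩
    obtain ⟨n, hn⟩ := exists_nat_ge |s|
    exact mem_iUnion.2 ⟨n, ht, s, abs_le.1 hn, hs⟩
  -- Countably many `Z n` cover an uncountable interval, so one of them is infinite and accumulates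
  -- at some `t₀`.
  obtain ⟨n, hn⟩ : ∃ n, (Z n).Infinite := by
    by_contra! hfin
    have hcount : (Icc 0 (ε / 2)).Countable :=
      (countable_iUnion fun n => (not_infinite.1 (by simpa using hfin n)).countable).mono hcover
    rw [Cardinal.Real.Icc_countable_iff] at hcount
    linarith [hε.1]
  obtain ⟨t₀, ht₀, hacc⟩ := hn.exists_accPt_of_subset_isCompact isCompact_Icc (sep_subset _ _)
  have ht₀1 : t₀ ∈ Icc (0 : ℝ) 1 := ⟨ht₀.1, by linarith [ht₀.2, hε.2, hε.1]⟩
  -- The arc is enlarged until its endpoints lie beyond the bound `C` of `Γ`.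
  obtain ⟨β, hβn, hβ⟩ := frequently_atTop.1 (htop C) n
  obtain ⟨α, hαn, hα⟩ := frequently_atBot.1 (hbot C) (-(n : ℝ))
  have hne : ∀ t ∈ Icc (0 : ℝ) 1, ∀ r, C < ‖k r‖ → k r ≠ Γ t := by
    intro t ht r hr he
    have := hC t ht
    rw [← he] at this
    linarith
  have hcore : ∀ t ∈ Icc (0 : ℝ) 1, (∃ᶠ t' in 𝓝[≠] t, Γ t' ∈ k '' Icc α β) →
      ∀ᶠ t' in 𝓝 t, Γ t' ∈ k '' Icc α β := fun t ht =>
    eventually_mem_image_arc hk hk' (hΓ t ht) (hne t ht α hα) (hne t ht β hβ)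
  let u : Set ℝ := {t | ∀ᶠ t' in 𝓝 t, Γ t' ∈ k '' Icc α β}
  have hu : IsOpen u := isOpen_setOfPred_eventually_nhds
  have hfreq₀ : ∃ᶠ t' in 𝓝[≠] t₀, Γ t' ∈ k '' Icc α β := by
    rw [accPt_iff_frequently_nhdsNE] at hacc
    exact hacc.mono fun t ht => image_mono (Icc_subset_Icc hαn hβn) ht.2
  -- The open set `u` is also relatively closed: at a limit point outside `u`, nearby points of `u`
  -- provide the punctured frequent condition that `hcore` needs.
  have hsub : Icc (0 : ℝ) 1 ⊆ u := by
    refine isPreconnected_Icc.subset_of_closure_inter_subset hu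
      ⟨t₀, ht₀1, hcore t₀ ht₀1 hfreq₀⟩ ?_
    rintro t ⟨htu, ht⟩
    by_cases htu' : t ∈ u
    · exact htu'
    refine hcore t ht ?_
    rw [frequently_nhdsWithin_iff]
    refine (mem_closure_iff_frequently.1 htu).mono fun t' ht' => ⟨ht'.self_of_nhds, ?_⟩
    rintro rfl
    exact htu' ht'
  intro t ht
  exact image_subset_range _ _ (hsub ht).self_of_nhds


namespace CatenoidTH

variable {ν : ℝ}

/-! ## Analytic completeness of the image -/

/-- The profile curve of `fTilde` in null coordinates. -/
def nullCurve (ν s : ℝ) : ℝ × ℝ := (nullComponent ν 1 s, nullComponent ν (-1) s)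

theorem analyticAt_nullCurve (ν s : ℝ) : AnalyticAt ℝ (nullCurve ν) s :=
  (analyticAt_nullComponent ν 1 s).prod (analyticAt_nullComponent ν (-1) s)

/-- Up to nonzero factors the two components are `cos s / ν ± sin s`; both vanish only if `sin s =
cos s = 0`. -/
theorem deriv_nullCurve_ne_zero (hν : 0 < ν) (s : ℝ) : deriv (nullCurve ν) s ≠ 0 := by
  have h1 : (1 : ℝ) ^ 2 = 1 := by norm_num
  have h2 : (-1 : ℝ) ^ 2 = 1 := by norm_num
  have h := (hasDerivAt_nullComponent hν h1 s).prodMk (hasDerivAt_nullComponent hν h2 s)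
  have e : deriv (nullCurve ν) s = _ := h.deriv
  rw [e]
  intro h0
  have ha := (amp_pos hν).ne'
  have e1 := congrArg Prod.fst h0
  have e2 := congrArg Prod.snd h0
  simp only [Prod.fst_zero, Prod.snd_zero] at e1 e2
  have f1 := (mul_eq_zero.1 e1).resolve_left (mul_ne_zero ha (cosh_add_mul_sinh_ne_zero h1 _))
  have f2 := (mul_eq_zero.1 e2).resolve_left (mul_ne_zero ha (cosh_add_mul_sinh_ne_zero h2 _))
  have hs : Real.sin s = 0 := by linarith
  have hc : Real.cos s / ν = 0 := by linarith
  have hc' : Real.cos s = 0 := by simpa [hν.ne'] using hc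
  have := Real.sin_sq_add_cos_sq s
  rw [hs, hc'] at this
  norm_num at this

/-- At a node `x₃ = ± cosh (s / ν)`. The nodes thus serve as barriers for bounded curves, although
`x₃` itself does not tend to infinity. -/
theorem abs_node_div_lt_abs_x₃ (hν : 0 < ν) (k : ℤ) : |node k| / ν < |x₃ ν (node k)| := by
  have hs : Real.sin (node k) = (-1 : ℝ) ^ k := by simpa using sin_node_add k 0
  have hc : Real.cos (node k) = 0 := cos_eq_zero_iff_node.2 ⟨k, rfl⟩
  have e : |x₃ ν (node k)| = Real.cosh (|node k| / ν) := by
    have h2 : |node k| / ν = |node k / ν| := by rw [abs_div, abs_of_pos hν]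
    rw [h2, Real.cosh_abs, x₃, hs, hc]
    simp [abs_of_pos (Real.cosh_pos _)]
  rw [e]
  exact (Real.self_le_sinh_iff.2 (by positivity)).trans_lt (Real.sinh_lt_cosh _)

theorem exists_le_node (M : ℝ) : ∃ k, M ≤ node k := by
  refine ⟨⌈|M|⌉, ?_⟩
  have h1 := Int.le_ceil |M|
  have h2 := le_abs_self M
  have h3 := abs_nonneg M
  have h4 := Real.pi_gt_three
  unfold node
  nlinarith

theorem exists_node_le (M : ℝ) : ∃ k, node k ≤ M := by
  obtain ⟨k, hk⟩ := exists_le_node (-M)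
  -- `node (-k - 1) = -node k`.
  refine ⟨-k - 1, ?_⟩
  unfold node at *
  push_cast
  linarith

theorem frequently_atTop_lt_abs_x₃ (hν : 0 < ν) (C : ℝ) : ∃ᶠ s in atTop, C < |x₃ ν s| := by
  refine frequently_atTop.2 fun a => ?_
  obtain ⟨k, hk⟩ := exists_le_node (max a (C * ν))
  refine ⟨node k, (le_max_left _ _).trans hk, lt_of_le_of_lt ?_ (abs_node_div_lt_abs_x₃ hν k)⟩
  rw [le_div_iff₀ hν]
  exact ((le_max_right _ _).trans hk).trans (le_abs_self _)

theorem frequently_atBot_lt_abs_x₃ (hν : 0 < ν) (C : ℝ) : ∃ᶠ s in atBot, C < |x₃ ν s| := by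
  refine frequently_atBot.2 fun a => ?_
  obtain ⟨k, hk⟩ := exists_node_le (min a (-(C * ν)))
  refine ⟨node k, hk.trans (min_le_left _ _), lt_of_le_of_lt ?_ (abs_node_div_lt_abs_x₃ hν k)⟩
  rw [le_div_iff₀ hν]
  have := hk.trans (min_le_right _ _)
  linarith [neg_le_abs (node k)]

theorem abs_x₃_le_norm_nullCurve (ν s : ℝ) : |x₃ ν s| ≤ ‖nullCurve ν s‖ := by
  have h1 := norm_fst_le (nullCurve ν s)
  have h2 := norm_snd_le (nullCurve ν s)
  rw [Real.norm_eq_abs] at h1 h2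
  have e : x₃ ν s = ((nullCurve ν s).1 + (nullCurve ν s).2) / 2 := by
    simp only [nullCurve, nullComponent]; ring
  rw [e, abs_div, abs_two]
  have := abs_add_le (nullCurve ν s).1 (nullCurve ν s).2
  linarith

/-! ### Continuity and analyticity of the maps, and their common image -/

theorem continuous_x₀ (ν : ℝ) : Continuous (x₀ ν) :=
  continuous_iff_continuousAt.2 fun s => (analyticAt_x₀ ν s).continuousAt

theorem continuous_x₃ (ν : ℝ) : Continuous (x₃ ν) :=
  continuous_iff_continuousAt.2 fun s => (analyticAt_x₃ ν s).continuousAt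

theorem continuous_fTilde (hν : 0 < ν) : Continuous (fTilde hν) := by
  have c : ∀ i : Fin 3, Continuous (fun p : X ν => p.1 i) := fun i =>
    (continuous_apply i).comp continuous_subtype_val
  refine Continuous.subtype_mk (continuous_pi fun i => ?_) _
  fin_cases i
  · exact (continuous_x₀ ν).comp (c 2)
  · exact c 0
  · exact c 1
  · exact (continuous_x₃ ν).comp (c 2)

theorem f_eq_fTilde_param (hν : 0 < ν) (q : ℝ × Real.Angle) :
    f hν q = fTilde hν (param ν q) := rfl

theorem f_eq_comp (hν : 0 < ν) : f hν = fTilde hν ∘ param ν :=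
  funext (f_eq_fTilde_param hν)

theorem continuous_f (hν : 0 < ν) : Continuous (f hν) := by
  rw [f_eq_comp]
  exact (continuous_fTilde hν).comp (continuous_param ν)

theorem analyticOnNhd_f (hν : 0 < ν) : AnalyticOnNhd ℝ
    (fun q : ℝ × ℝ => (f hν (q.1, (q.2 : Real.Angle)) : Fin 4 → ℝ)) univ := by
  intro q _
  have h1 : AnalyticAt ℝ (fun q : ℝ × ℝ => q.1) q := analyticAt_fst
  have h2 : AnalyticAt ℝ (fun q : ℝ × ℝ => q.2) q := analyticAt_snd
  have hr : AnalyticAt ℝ (fun q : ℝ × ℝ => radius ν q.1) q :=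
    analyticAt_const.mul (Real.analyticAt_cos.fun_comp h1)
  have e : (fun q : ℝ × ℝ => (f hν (q.1, (q.2 : Real.Angle)) : Fin 4 → ℝ)) = fun q =>
      ![x₀ ν q.1, radius ν q.1 * Real.cos q.2, radius ν q.1 * Real.sin q.2, x₃ ν q.1] := rfl
  rw [e]
  refine AnalyticAt.pi fun i => ?_
  fin_cases i
  · exact (analyticAt_x₀ ν q.1).fun_comp h1
  · exact hr.mul (Real.analyticAt_cos.fun_comp h2)
  · exact hr.mul (Real.analyticAt_sin.fun_comp h2)
  · exact (analyticAt_x₃ ν q.1).fun_comp h1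

theorem range_f (hν : 0 < ν) : range (f hν) = range (fTilde hν) := by
  rw [f_eq_comp]
  exact (surjective_param ν).range_comp (fTilde hν)

theorem mem_range_fTilde_iff (hν : 0 < ν) {p : Fin 4 → ℝ} (hp : p ∈ deSitter3) :
    p ∈ Subtype.val '' range (fTilde hν) ↔ (p 3 + p 0, p 3 - p 0) ∈ range (nullCurve ν) := by
  constructor
  · rintro ⟨_, ⟨q, rfl⟩, rfl⟩
    refine ⟨q.1 2, Prod.ext ?_ ?_⟩ <;> simp [nullCurve, nullComponent, fTilde]
    ring
  · rintro ⟨s, hs⟩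
    have h1 := congrArg Prod.fst hs
    have h2 := congrArg Prod.snd hs
    simp only [nullCurve, nullComponent] at h1 h2
    have h0 : x₀ ν s = p 0 := by linarith
    have h3 : x₃ ν s = p 3 := by linarith
    have hX : ![p 1, p 2, s] ∈ X ν := by
      -- Any point of `X` at height `s` has the same `x₀` and `x₃`; comparing its de Sitter equation
      -- with that of `p` yields `p 1 ^ 2 + p 2 ^ 2`.
      have hm : ![amp ν * Real.cos s, 0, s] ∈ X ν := by rw [mem_X]; simp
      have hd := mem_deSitter3_iff.1 (fTilde hν ⟨_, hm⟩).2
      simp only [fTilde, Matrix.cons_val] at hd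
      rw [mem_X]
      rw [mem_deSitter3_iff] at hp
      simp only [Matrix.cons_val]
      rw [h0, h3] at hd
      linarith
    refine ⟨_, ⟨⟨_, hX⟩, rfl⟩, ?_⟩
    ext i
    fin_cases i <;> simp [fTilde, h0, h3]

theorem isAnalyticallyComplete_range_f (hν : 0 < ν) : IsAnalyticallyComplete (range (f hν)) := by
  refine ⟨⟨_, mem_range_self (0, 0)⟩, fun Γ hΓ hΓN h t ht => ?_⟩
  obtain ⟨ε, hε, hS⟩ := h
  rw [range_f] at hS ⊢
  rw [mem_range_fTilde_iff hν (hΓN t ht)]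
  refine mem_range_of_analytic (analyticAt_nullCurve ν) (deriv_nullCurve_ne_zero hν)
    (fun C => (frequently_atTop_lt_abs_x₃ hν C).mono fun s hs =>
      hs.trans_le (abs_x₃_le_norm_nullCurve ν s))
    (fun C => (frequently_atBot_lt_abs_x₃ hν C).mono fun s hs =>
      hs.trans_le (abs_x₃_le_norm_nullCurve ν s))
    (Γ := fun t => (Γ t 3 + Γ t 0, Γ t 3 - Γ t 0)) (fun t ht => ?_) hε (fun t ht => ?_) t ht
  · have h0 := (analyticAt_proj 0 (Γ t)).fun_comp (hΓ t ht)
    have h3 := (analyticAt_proj 3 (Γ t)).fun_comp (hΓ t ht)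
    exact (h3.add h0).prod (h3.sub h0)
  · exact (mem_range_fTilde_iff hν (hΓN t ⟨ht.1, ht.2.le.trans hε.2.le⟩)).1 (hS t ht)

/-! ## Properness -/

theorem isClosed_deSitter3 : IsClosed deSitter3 := by
  have : deSitter3 = {p | -(p 0 * p 0) + p 1 * p 1 + p 2 * p 2 + p 3 * p 3 = 1} := rfl
  rw [this]
  exact isClosed_eq (by fun_prop) continuous_const

/-- Where `tan s = (ν² - 1) / (2ν)`, the growing exponentials cancel and `x₃ = -x₀ = sin s * exp (-s
/ ν)`. Such `s` recur with period `2π`. -/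
theorem exists_fTilde_mem_closedBall (hν : 0 < ν) (M : ℝ) :
    ∃ p : X ν, M ≤ p.1 2 ∧ (fTilde hν p : Fin 4 → ℝ) ∈ Metric.closedBall 0 1 := by
  have ha := amp_pos hν
  -- The two values lie on the unit circle because `(ν² + 1)² = 4ν² + (ν² - 1)²`; this cosine makes
  -- the radius equal to `1`.
  obtain ⟨θ, hc, hs⟩ := exists_cos_sin_eq (x := 1 / amp ν)
    (y := (ν ^ 2 - 1) / (2 * ν) / amp ν) (by unfold amp; field_simp; ring)
  obtain ⟨n, hn⟩ := exists_nat_ge |max M 0 - θ|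
  set s := θ + n * (2 * Real.pi) with hsdef
  have hcs : Real.cos s = 1 / amp ν := by rw [hsdef, Real.cos_add_nat_mul_two_pi, hc]
  have hss : Real.sin s = (ν ^ 2 - 1) / (2 * ν) / amp ν := by
    rw [hsdef, Real.sin_add_nat_mul_two_pi, hs]
  have hMs : max M 0 ≤ s := by
    have h1 := le_abs_self (max M 0 - θ)
    have h2 := Real.pi_gt_three
    have h3 : (0 : ℝ) ≤ n := Nat.cast_nonneg n
    nlinarith
  have hX : ![1, 0, s] ∈ X ν := by
    rw [mem_X]
    simp [hcs, ha.ne']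
  have hexp : |Real.sin s * Real.exp (-(s / ν))| ≤ 1 := by
    rw [abs_mul, Real.abs_exp]
    refine mul_le_one₀ (Real.abs_sin_le_one s) (Real.exp_pos _).le (Real.exp_le_one_iff.2 ?_)
    have : 0 ≤ s / ν := div_nonneg ((le_max_right _ _).trans hMs) hν.le
    linarith
  have hd : (ν ^ 2 - 1) * Real.cos s = Real.sin s * (2 * ν) := by
    rw [hcs, hss]; field_simp
  have h3 : x₃ ν s = Real.sin s * Real.exp (-(s / ν)) := by
    rw [← Real.cosh_sub_sinh, x₃, hd]
    field_simp
  have h0 : x₀ ν s = -(Real.sin s * Real.exp (-(s / ν))) := by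
    rw [← Real.cosh_sub_sinh, x₀, hd]
    field_simp
    ring
  refine ⟨⟨_, hX⟩, (le_max_left _ _).trans hMs, ?_⟩
  rw [mem_closedBall_zero_iff, pi_norm_le_iff_of_nonneg zero_le_one]
  intro i
  fin_cases i
  · change |x₀ ν s| ≤ 1
    rwa [h0, abs_neg]
  · change |(1 : ℝ)| ≤ 1
    simp
  · change |(0 : ℝ)| ≤ 1
    simp
  · change |x₃ ν s| ≤ 1
    rwa [h3]

theorem not_isProperMap_fTilde (hν : 0 < ν) : ¬ IsProperMap (fTilde hν) := by
  intro h
  have hK : IsCompact (Subtype.val ⁻¹' Metric.closedBall 0 1 : Set deSitter3) :=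
    isClosed_deSitter3.isClosedEmbedding_subtypeVal.isCompact_preimage
      (isCompact_closedBall (0 : Fin 4 → ℝ) 1)
  have c : Continuous (fun p : X ν => p.1 2) :=
    (continuous_apply (2 : Fin 3)).comp continuous_subtype_val
  obtain ⟨M, hM⟩ := ((h.isCompact_preimage hK).image c).bddAbove
  obtain ⟨p, hp, hpK⟩ := exists_fTilde_mem_closedBall hν (M + 1)
  have := hM (mem_image_of_mem _ hpK)
  linarith

theorem not_isProperMap_f (hν : 0 < ν) : ¬ IsProperMap (f hν) := by
  rw [f_eq_comp]
  exact fun h => not_isProperMap_fTilde hν (isProperMap_of_comp_of_surj (continuous_param ν)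
    (continuous_fTilde hν) h (surjective_param ν))

theorem mem_Icc_of_forall_ne {s : ℝ → ℝ} {I : Set ℝ} (hI : IsPreconnected I)
    (hs : ContinuousOn s I) {α β t₀ : ℝ} (ht₀ : t₀ ∈ I) (h₀ : s t₀ ∈ Icc α β)
    (hα : ∀ t ∈ I, s t ≠ α) (hβ : ∀ t ∈ I, s t ≠ β) {t : ℝ} (ht : t ∈ I) : s t ∈ Icc α β := by
  have hc := (hI.image s hs).ordConnected
  constructor
  · by_contra! h
    obtain ⟨r, hr, hrα⟩ := hc.out (mem_image_of_mem s ht) (mem_image_of_mem s ht₀) ⟨h.le, h₀.1⟩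
    exact hα r hr hrα
  · by_contra! h
    obtain ⟨r, hr, hrβ⟩ := hc.out (mem_image_of_mem s ht₀) (mem_image_of_mem s ht) ⟨h₀.2, h.le⟩
    exact hβ r hr hrβ

theorem isCompact_slab (ν α β : ℝ) : IsCompact {p : X ν | p.1 2 ∈ Icc α β} := by
  have hcl : IsClosed {p : X ν | p.1 2 ∈ Icc α β} :=
    isClosed_Icc.preimage ((continuous_apply (2 : Fin 3)).comp continuous_subtype_val)
  let K : Set (Fin 3 → ℝ) := Set.pi univ
    ![Icc (-|amp ν|) |amp ν|, Icc (-|amp ν|) |amp ν|, Icc α β]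
  have hK : IsCompact K := isCompact_univ_pi fun i => by
    fin_cases i <;> exact isCompact_Icc
  refine ((isClosed_X ν).isClosedEmbedding_subtypeVal.isCompact_preimage hK).of_isClosed_subset
    hcl fun p hp => ?_
  have hX := mem_X.1 p.2
  have hc := Real.cos_sq_le_one (p.1 2)
  have hle : (amp ν * Real.cos (p.1 2)) ^ 2 ≤ amp ν ^ 2 := by
    rw [mul_pow]; exact mul_le_of_le_one_right (sq_nonneg _) hc
  intro i _
  fin_cases i
  · exact abs_le.1 (sq_le_sq.1 (show p.1 0 ^ 2 ≤ _ by nlinarith [sq_nonneg (p.1 1)]))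
  · exact abs_le.1 (sq_le_sq.1 (show p.1 1 ^ 2 ≤ _ by nlinarith [sq_nonneg (p.1 0)]))
  · exact hp

/-- The extension `Γ` is bounded by some `C` on `[0, 1]`. Parameters `α, β` with `|x₃| > C` on both
sides of the initial height cannot be crossed, so `σ` stays in a compact slab and any sequence
tending to `1` has a suitable subsequence. -/
theorem isArcProper_fTilde (hν : 0 < ν) : IsArcProper 0 (fTilde hν) := by
  refine ⟨continuous_fTilde hν, ?_⟩
  rintro σ hσ ⟨Γ, hΓ, -, hΓσ⟩
  obtain ⟨C, hC⟩ := isCompact_Icc.exists_bound_of_continuousOn hΓ.continuousOn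
  have c : ContinuousOn (fun t => (σ t).1 2) (Ico 0 1) :=
    ((continuous_apply (2 : Fin 3)).comp continuous_subtype_val).comp_continuousOn hσ
  have h0 : (0 : ℝ) ∈ Ico (0 : ℝ) 1 := ⟨le_rfl, one_pos⟩
  obtain ⟨β, hβ0, hβ⟩ := frequently_atTop.1 (frequently_atTop_lt_abs_x₃ hν C) ((σ 0).1 2)
  obtain ⟨α, hα0, hα⟩ := frequently_atBot.1 (frequently_atBot_lt_abs_x₃ hν C) ((σ 0).1 2)
  have hne : ∀ r, C < |x₃ ν r| → ∀ t ∈ Ico (0 : ℝ) 1, (σ t).1 2 ≠ r := by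
    rintro r hr t ht rfl
    have h1 := hC t ⟨ht.1, ht.2.le⟩
    have h2 := norm_le_pi_norm (Γ t) 3
    have h3 : Γ t 3 = x₃ ν ((σ t).1 2) := by rw [hΓσ t ht]; rfl
    rw [h3, Real.norm_eq_abs] at h2
    linarith
  have hmem : ∀ t ∈ Ico (0 : ℝ) 1, (σ t).1 2 ∈ Icc α β := fun t ht =>
    mem_Icc_of_forall_ne isPreconnected_Ico c h0 ⟨hα0, hβ0⟩ (hne α hα) (hne β hβ) ht
  let u : ℕ → ℝ := fun n => 1 - 1 / ((n : ℝ) + 1)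
  have hu : ∀ n, u n ∈ Ico (0 : ℝ) 1 := by
    intro n
    have h1 : 0 < 1 / ((n : ℝ) + 1) := by positivity
    have h2 : 1 / ((n : ℝ) + 1) ≤ 1 := by
      rw [div_le_one (by positivity)]; linarith [(Nat.cast_nonneg n : (0 : ℝ) ≤ n)]
    exact ⟨by simp only [u]; linarith, by simp only [u]; linarith⟩
  have hu1 : Tendsto u atTop (𝓝 1) := by
    simpa [u] using tendsto_one_div_add_atTop_nhds_zero_nat (𝕜 := ℝ) |>.const_sub 1
  obtain ⟨p, -, φ, hφ, hp⟩ := (isCompact_slab ν α β).tendsto_subseq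
    (x := fun n => σ (u n)) fun n => hmem _ (hu n)
  exact ⟨u ∘ φ, fun n => hu _, hu1.comp hφ.tendsto_atTop, p, hp⟩

end CatenoidTH

end

theorem mainTheorem7 (ν : ℝ) (hν : 0 < ν) (hν1 : ν ≠ 1) :
    -- the map `f` is real analytic, and `fTilde` realizes it on `X`
    Continuous (CatenoidTH.f hν) ∧
    AnalyticOnNhd ℝ
      (fun q : ℝ × ℝ => (CatenoidTH.f hν (q.1, (q.2 : Real.Angle)) : Fin 4 → ℝ)) Set.univ ∧
    (∀ q, CatenoidTH.f hν q = CatenoidTH.fTilde hν (CatenoidTH.param ν q)) ∧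
    Set.range (CatenoidTH.f hν) = Set.range (CatenoidTH.fTilde hν) ∧
    -- `X` is a DC-manifold, as a subset of `ℝ³`, with its countably many DC-points,
    -- and `fTilde` is a space-like CMC-1 DC-immersion
    (∃ D : DCStructure 2 (CatenoidTH.X ν),
      D.IsDCImmersion 3 (CatenoidTH.incl ν) ∧
      (Subtype.val '' D.dcPoints : Set (Fin 3 → ℝ)) =
        {p | ∃ k : ℤ, p = ![0, 0, Real.pi / 2 + Real.pi * k]} ∧
      D.dcPoints.Countable ∧ D.dcPoints.Infinite ∧
      D.IsSpacelikeCMC1DCImmersion (CatenoidTH.fTilde hν)) ∧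
    -- the image is analytically complete
    IsAnalyticallyComplete (Set.range (CatenoidTH.f hν)) ∧
    -- the maps are not proper, but `fTilde` is `C⁰`-arc-proper
    ¬ IsProperMap (CatenoidTH.f hν) ∧
    ¬ IsProperMap (CatenoidTH.fTilde hν) ∧
    IsArcProper 0 (CatenoidTH.fTilde hν) := by
  refine ⟨CatenoidTH.continuous_f hν, CatenoidTH.analyticOnNhd_f hν,
    CatenoidTH.f_eq_fTilde_param hν, CatenoidTH.range_f hν,
    ⟨CatenoidTH.dcStructure hν, CatenoidTH.isDCImmersion_incl hν, CatenoidTH.image_dcPoints hν,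
      CatenoidTH.countable_dcPoints hν, CatenoidTH.infinite_dcPoints hν,
      CatenoidTH.isSpacelikeCMC1DCImmersion_fTilde hν hν1⟩,
    CatenoidTH.isAnalyticallyComplete_range_f hν, CatenoidTH.not_isProperMap_f hν,
    CatenoidTH.not_isProperMap_fTilde hν, CatenoidTH.isArcProper_fTilde hν⟩
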